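/- Let $n,k\ge 0$ be integers such that $m:=n+k$ is even, write $D:=-\mathrm{i}\,\frac{d}{dx}$, and let $a_\alpha$ ($0\le\alpha\le m$), $b_\beta$ ($0\le\beta\le n$), $c_\gamma$ ($0\le\gamma\le k$) and $d$ be functions in $C^\infty(\mathbb{R},\mathbb{C})$ with $a_m(x)\ne 0$ for all $x\in\mathbb{R}$. Put $\Delta:=d-\dfrac{b_nc_k}{a_m}$ and $\Omega:=\mathbb{C}\setminus\bigl(\mathrm{cl}\{\Delta(\mathbb{R})\}\cup\mathrm{cl}\{d(\mathbb{R})\}\bigr)$. For $\lambda\in\mathbb{C}\setminus\mathrm{cl}\{d(\mathbb{R})\}$ consider the differential expression $$\tau_S(\lambda)=\sum_{\alpha=0}^m a_\alpha D^\alpha-\lambda-\Bigl(\sum_{\beta=0}^n b_\beta D^\beta\Bigr)\frac1{d-\lambda}\Bigl(\sum_{\gamma=0}^k c_\gamma D^\gamma\Bigr)=\sum_{j=0}^m p_j(\cdot,\lambda)D^j,$$ where $p_j(\cdot,\lambda)$ are the coefficients obtained by expanding with the Leibniz rule. Let $B^\infty(\mathbb{R},\mathbb{C})$ be the space of $C^\infty$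 functions on $\mathbb{R}$ all of whose derivatives (including that of order $0$) are bounded. Assume that for every $\lambda\in\Omega$: 1. $p_j(\cdot,\lambda)\in B^\infty(\mathbb{R},\mathbb{C})$ for $0\le j\le m$; 2. there are constants $\theta_\lambda\in\mathbb{R}$ and $\delta_\lambda>0$ such that $\mathrm{Re}\bigl(e^{\mathrm{i}\theta_\lambda}p_m(x,\lambda)\bigr)\ge\delta_\lambda$ for all $x\in\mathbb{R}$; 3. $c_\gamma(d-\lambda)^{-1}\in B^\infty(\mathbb{R},\mathbb{C})$ for $0\le\gamma\le k$, and $\bigl(b_\beta(d-\lambda)^{-1}\bigr)^{(j)}\in B^\infty(\mathbb{R},\mathbb{C})$ for $0\le\beta\le n$ and $0\le j\le\beta$. Let $\lambda\in\Omega$ and let $S(\lambda)$ be the closure in $L^2(\mathbb{R})$ of the operator $S_0(\lambda)u:=\tau_S(\lambda)u$ whose domain is the Schwartz space $\mathscr{S}(\mathbb{R})$. Let $W(S(\lambda)):=\{\langle S(\lambda)u,u\rangle:\ u\in\mathrm{Dom}(S(\lambda)),\ \|u\|_{L^2(\mathbb{R})}=1\}$ be its numerical range and $\rho(S(\lambda))$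 its resolvent set. Then there are $z_0\in\mathbb{C}$, $\psi\in\mathbb{R}$ and $\vartheta\in[0,\frac{\pi}{2})$ such that $$\mathrm{cl}\{W(S(\lambda))\}\subset\bigl\{z_0+re^{\mathrm{i}(\psi+t)}:\ r\ge0,\ |t|\le\vartheta\bigr\},$$ that is, the closure of the numerical range is contained in a sector of semi-angle $\vartheta<\frac{\pi}{2}$. Moreover, $$\mathbb{C}\setminus\mathrm{cl}\{W(S(\lambda))\}\subset\rho(S(\lambda)).$$ -/

import Mathlib

open MeasureTheory
open scoped ContDiff SchwartzMap

noncomputable section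

/-! ### Differential expressions on the real line -/

/-- The power `D ^ j` of the momentum operator `D = -i d/dx`, applied to a function. -/
def momentumPow (j : ℕ) (u : ℝ → ℂ) : ℝ → ℂ :=
  fun x => (-Complex.I) ^ j * iteratedDeriv j u x

/-- The differential expression `∑_{j ≤ N} q_j D ^ j`, applied to a function. -/
def diffExpr (N : ℕ) (q : ℕ → ℝ → ℂ) (u : ℝ → ℂ) : ℝ → ℂ :=
  fun x => ∑ j ∈ Finset.range (N + 1), q j x * momentumPow j u x

/-- Smooth functions on the line all of whose derivatives (of order `0, 1, 2, …`) are bounded. -/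
def IsBInfty (f : ℝ → ℂ) : Prop :=
  ContDiff ℝ ∞ f ∧ ∀ j : ℕ, ∃ C : ℝ, ∀ x : ℝ, ‖iteratedDeriv j f x‖ ≤ C

/-- The coefficient functions of the operator matrix
`[∑_{α ≤ n+k} a_α D^α, ∑_{β ≤ n} b_β D^β; ∑_{γ ≤ k} c_γ D^γ, d]`. Only the values `a α` for
`α ≤ n + k`, `b β` for `β ≤ n` and `c γ` for `γ ≤ k` are ever used. -/
structure MatrixCoeffs where
  n : ℕ
  k : ℕ
  a : ℕ → ℝ → ℂ
  b : ℕ → ℝ → ℂ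
  c : ℕ → ℝ → ℂ
  d : ℝ → ℂ

namespace MatrixCoeffs

/-- The order `m = n + k` of the upper left entry. -/
def m (K : MatrixCoeffs) : ℕ := K.n + K.k

/-- Smoothness of all the coefficients, and `a_m` has no zero. -/
structure AssumptionA (K : MatrixCoeffs) : Prop where
  smooth_a : ∀ α ≤ K.m, ContDiff ℝ ∞ (K.a α)
  smooth_b : ∀ β ≤ K.n, ContDiff ℝ ∞ (K.b β)
  smooth_c : ∀ γ ≤ K.k, ContDiff ℝ ∞ (K.c γ)
  smooth_d : ContDiff ℝ ∞ K.d
  a_ne_zero : ∀ x, K.a K.m x ≠ 0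

/-- The function `Δ = d - b_n c_k / a_m`. -/
def Delta (K : MatrixCoeffs) : ℝ → ℂ :=
  fun x => K.d x - K.b K.n x * K.c K.k x / K.a K.m x

/-- The Schur complement expression
`τ_S(lam) = τ₁₁ - lam - τ₁₂ (τ₂₂ - lam)⁻¹ τ₂₁`, applied to a function. -/
def schurExpr (K : MatrixCoeffs) (lam : ℂ) (u : ℝ → ℂ) : ℝ → ℂ :=
  fun x => diffExpr K.m K.a u x - lam * u x
    - diffExpr K.n K.b (fun y => (K.d y - lam)⁻¹ * diffExpr K.k K.c u y) x

/-- The coefficient `p_j(·, lam)` of `D ^ j` in the standard form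
`τ_S(lam) = ∑_{j ≤ m} p_j(·, lam) D ^ j`, as given by the Leibniz rule
(see `schurExpr_eq_diffExpr` below). -/
def schurCoeff (K : MatrixCoeffs) (lam : ℂ) (j : ℕ) : ℝ → ℂ :=
  fun x => K.a j x - (if j = 0 then lam else 0)
    - ∑ β ∈ Finset.range (K.n + 1), ∑ γ ∈ Finset.range (K.k + 1),
        if γ ≤ j ∧ j ≤ β + γ then
          (β.choose (j - γ) : ℂ) * K.b β x *
            momentumPow (β + γ - j) (fun y => K.c γ y / (K.d y - lam)) x
        else 0

/-- The conditions on the coefficients under which the Schur complement is strongly elliptic,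
for every `lam` outside the closures of the ranges of `Δ` and `d`. The constants `θ` and `δ`
may depend on `lam`. The angle `θ` is an arbitrary real number. -/
structure AssumptionC (K : MatrixCoeffs) : Prop where
  schur_bounded : ∀ lam : ℂ,
    lam ∉ closure (Set.range K.Delta) ∪ closure (Set.range K.d) →
    ∀ j ≤ K.m, IsBInfty (K.schurCoeff lam j)
  strongly_elliptic : ∀ lam : ℂ,
    lam ∉ closure (Set.range K.Delta) ∪ closure (Set.range K.d) →
    ∃ θ : ℝ, ∃ δ > (0 : ℝ), ∀ x : ℝ,
      δ ≤ (Complex.exp (θ * Complex.I) * K.schurCoeff lam K.m x).re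
  c_bounded : ∀ lam : ℂ,
    lam ∉ closure (Set.range K.Delta) ∪ closure (Set.range K.d) →
    ∀ γ ≤ K.k, IsBInfty (fun x => K.c γ x * (K.d x - lam)⁻¹)
  b_bounded : ∀ lam : ℂ,
    lam ∉ closure (Set.range K.Delta) ∪ closure (Set.range K.d) →
    ∀ β ≤ K.n, ∀ j ≤ β, IsBInfty (iteratedDeriv j (fun x => K.b β x * (K.d x - lam)⁻¹))

end MatrixCoeffs

/-! ### The standard form of the Schur complement -/

lemma momentumPow_add (j : ℕ) {u v : ℝ → ℂ} (hu : ContDiff ℝ ∞ u) (hv : ContDiff ℝ ∞ v) (x : ℝ) :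
    momentumPow j (fun y => u y + v y) x = momentumPow j u x + momentumPow j v x := by
  unfold momentumPow
  rw [iteratedDeriv_fun_add ((hu.of_le (by exact_mod_cast le_top)).contDiffAt)
    ((hv.of_le (by exact_mod_cast le_top)).contDiffAt)]
  ring

lemma momentumPow_const_mul (j : ℕ) (r : ℂ) (u : ℝ → ℂ) (x : ℝ) :
    momentumPow j (fun y => r * u y) x = r * momentumPow j u x := by
  unfold momentumPow
  have h : iteratedDeriv j (fun y => r * u y) x = r * iteratedDeriv j u x :=
    iteratedDeriv_const_mul_field r u
  rw [h]
  ring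

lemma contDiff_momentumPow (j : ℕ) {u : ℝ → ℂ} (hu : ContDiff ℝ ∞ u) :
    ContDiff ℝ ∞ (momentumPow j u) := by
  unfold momentumPow
  refine contDiff_const.mul ?_
  rw [iteratedDeriv_eq_iterate]
  exact hu.iterate_deriv j

lemma momentumPow_momentumPow (i j : ℕ) (u : ℝ → ℂ) (x : ℝ) :
    momentumPow i (momentumPow j u) x = momentumPow (i + j) u x := by
  have h : momentumPow j u = fun y => (-Complex.I) ^ j * iteratedDeriv j u y := rfl
  rw [h, momentumPow_const_mul]
  unfold momentumPow
  rw [iteratedDeriv_eq_iterate, iteratedDeriv_eq_iterate, iteratedDeriv_eq_iterate,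
    ← Function.iterate_add_apply]
  ring

lemma momentumPow_sum (j N : ℕ) {f : ℕ → ℝ → ℂ} (hf : ∀ i < N, ContDiff ℝ ∞ (f i)) (x : ℝ) :
    momentumPow j (fun y => ∑ i ∈ Finset.range N, f i y) x
      = ∑ i ∈ Finset.range N, momentumPow j (f i) x := by
  induction N with
  | zero =>
    have := momentumPow_const_mul j 0 (fun _ => 0) x
    simpa using this
  | succ N ih =>
    simp only [Finset.sum_range_succ]
    rw [momentumPow_add j (ContDiff.sum fun i hi => hf i (by
      have := Finset.mem_range.1 hi; omega)) (hf N (by omega)),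
      ih fun i hi => hf i (by omega)]

/-- The Leibniz rule. -/
lemma momentumPow_mul (j : ℕ) {u v : ℝ → ℂ} (hu : ContDiff ℝ ∞ u) (hv : ContDiff ℝ ∞ v) (x : ℝ) :
    momentumPow j (fun y => u y * v y) x
      = ∑ i ∈ Finset.range (j + 1),
          (j.choose i : ℂ) * momentumPow (j - i) u x * momentumPow i v x := by
  unfold momentumPow
  rw [iteratedDeriv_fun_mul ((hu.of_le (by exact_mod_cast le_top)).contDiffAt)
    ((hv.of_le (by exact_mod_cast le_top)).contDiffAt), Finset.mul_sum,
    ← Finset.sum_range_reflect]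
  refine Finset.sum_congr rfl fun i hi => ?_
  have hi' : i ≤ j := by have := Finset.mem_range.1 hi; omega
  have e1 : j + 1 - 1 - i = j - i := by omega
  have e2 : j - (j - i) = i := by omega
  rw [e1, e2, Nat.choose_symm hi']
  have e3 : (-Complex.I) ^ j = (-Complex.I) ^ (j - i) * (-Complex.I) ^ i := by
    rw [← pow_add]; congr 1; omega
  rw [e3]
  ring

lemma contDiff_div_sub {K : MatrixCoeffs} (hA : K.AssumptionA) {lam : ℂ}
    (hd : lam ∉ closure (Set.range K.d)) {γ : ℕ} (hγ : γ ≤ K.k) :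
    ContDiff ℝ ∞ (fun y => K.c γ y / (K.d y - lam)) := by
  have h1 : ContDiff ℝ ∞ (fun y => K.d y - lam) := hA.smooth_d.sub contDiff_const
  have h2 : ∀ y, K.d y - lam ≠ 0 := fun y h =>
    hd (subset_closure ⟨y, by linear_combination h⟩)
  simp only [div_eq_mul_inv]
  exact (hA.smooth_c γ hγ).mul (h1.inv h2)

/-- For smooth `u`, the Schur complement expression has the standard form
`∑_{j ≤ m} p_j(·, lam) D ^ j u`. -/
theorem schurExpr_eq_diffExpr {K : MatrixCoeffs} (hA : K.AssumptionA) {lam : ℂ}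
    (hd : lam ∉ closure (Set.range K.d)) {u : ℝ → ℂ} (hu : ContDiff ℝ ∞ u) :
    K.schurExpr lam u = diffExpr K.m (K.schurCoeff lam) u := by
  funext x
  have key : diffExpr K.n K.b (fun y => (K.d y - lam)⁻¹ * diffExpr K.k K.c u y) x
      = ∑ β ∈ Finset.range (K.n + 1), ∑ γ ∈ Finset.range (K.k + 1),
          ∑ j ∈ Finset.range (K.m + 1), (if γ ≤ j ∧ j ≤ β + γ then
          (β.choose (j - γ) : ℂ) * K.b β x *
            momentumPow (β + γ - j) (fun y => K.c γ y / (K.d y - lam)) x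
          else 0) * momentumPow j u x := by
    rw [diffExpr]
    refine Finset.sum_congr rfl fun β hβ => ?_
    have hβ' : β ≤ K.n := by have := Finset.mem_range.1 hβ; omega
    have h1 : (fun y => (K.d y - lam)⁻¹ * diffExpr K.k K.c u y) = fun y =>
        ∑ γ ∈ Finset.range (K.k + 1), (K.c γ y / (K.d y - lam)) * momentumPow γ u y := by
      funext y
      rw [diffExpr, Finset.mul_sum]
      exact Finset.sum_congr rfl fun γ _ => by rw [div_eq_mul_inv]; ring
    rw [h1, momentumPow_sum β (K.k + 1) (f := fun γ y =>
      (K.c γ y / (K.d y - lam)) * momentumPow γ u y)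
      (fun γ hγ => (contDiff_div_sub hA hd (by omega)).mul (contDiff_momentumPow γ hu)),
      Finset.mul_sum]
    refine Finset.sum_congr rfl fun γ hγ => ?_
    have hγ' : γ ≤ K.k := by have := Finset.mem_range.1 hγ; omega
    rw [momentumPow_mul β (contDiff_div_sub hA hd hγ') (contDiff_momentumPow γ hu),
      Finset.mul_sum]
    simp only [ite_mul, zero_mul]
    rw [← Finset.sum_filter]
    refine Finset.sum_bij (fun i _ => i + γ) ?_ ?_ ?_ ?_
    · intro i hi
      have := Finset.mem_range.1 hi
      simp only [Finset.mem_filter, Finset.mem_range, MatrixCoeffs.m]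
      omega
    · intro i _ i' _ h
      omega
    · intro j hj
      simp only [Finset.mem_filter, Finset.mem_range] at hj
      exact ⟨j - γ, by simp only [Finset.mem_range]; omega, by omega⟩
    · intro i hi
      have := Finset.mem_range.1 hi
      have e1 : i + γ - γ = i := by omega
      have e2 : β + γ - (i + γ) = β - i := by omega
      rw [momentumPow_momentumPow, e1, e2]
      ring
  have key2 : ∑ j ∈ Finset.range (K.m + 1), (if j = 0 then lam else 0) * momentumPow j u x
      = lam * u x := by
    rw [Finset.sum_eq_single 0]
    · simp [momentumPow]
    · intro j _ hj
      simp [hj]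
    · simp
  rw [MatrixCoeffs.schurExpr, key, ← key2]
  simp only [diffExpr, MatrixCoeffs.schurCoeff, sub_mul, Finset.sum_sub_distrib, Finset.sum_mul]
  congr 1
  exact (Finset.sum_congr rfl fun β _ => Finset.sum_comm).trans Finset.sum_comm

/-! ### The Schur complement as a closed operator in `L²(ℝ)` -/

/-- The Hilbert space `L²(ℝ)`. -/
abbrev L2R : Type := Lp ℂ 2 (volume : Measure ℝ)

/-- The graph of the operator `φ ↦ τ_S(lam) φ` in `L²(ℝ)` defined on Schwartz functions. -/
def schurGraph (K : MatrixCoeffs) (hA : K.AssumptionA) (lam : ℂ)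
    (hd : lam ∉ closure (Set.range K.d)) : Submodule ℂ (L2R × L2R) where
  carrier := {p | ∃ φ : 𝓢(ℝ, ℂ), (p.1 : ℝ → ℂ) =ᵐ[volume] φ ∧
    (p.2 : ℝ → ℂ) =ᵐ[volume] K.schurExpr lam φ}
  zero_mem' := by
    refine ⟨0, Lp.coeFn_zero ℂ 2 volume, ?_⟩
    rw [schurExpr_eq_diffExpr hA hd (SchwartzMap.smooth _ ⊤)]
    refine (Lp.coeFn_zero ℂ 2 volume).trans (Filter.Eventually.of_forall fun x => ?_)
    have h (j : ℕ) : momentumPow j (⇑(0 : 𝓢(ℝ, ℂ))) x = 0 := by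
      have h' := momentumPow_const_mul j 0 (fun _ => 0) x
      simp only [zero_mul] at h'
      exact h'
    simp only [diffExpr, h, mul_zero, Finset.sum_const_zero, Pi.zero_apply]
  add_mem' := by
    rintro p q ⟨φ, h1, h2⟩ ⟨ψ, h3, h4⟩
    refine ⟨φ + ψ, ?_, ?_⟩
    · filter_upwards [Lp.coeFn_add p.1 q.1, h1, h3] with x hx hx1 hx3
      rw [Prod.fst_add, hx, Pi.add_apply, hx1, hx3, add_apply]
    · rw [schurExpr_eq_diffExpr hA hd (SchwartzMap.smooth _ ⊤)] at h2 h4 ⊢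
      filter_upwards [Lp.coeFn_add p.2 q.2, h2, h4] with x hx hx2 hx4
      have h (j : ℕ) : momentumPow j (⇑(φ + ψ)) x = momentumPow j φ x + momentumPow j ψ x :=
        momentumPow_add j (SchwartzMap.smooth _ ⊤) (SchwartzMap.smooth _ ⊤) x
      rw [Prod.snd_add, hx, Pi.add_apply, hx2, hx4]
      simp only [diffExpr, h, mul_add, Finset.sum_add_distrib]
  smul_mem' := by
    rintro r p ⟨φ, h1, h2⟩
    refine ⟨r • φ, ?_, ?_⟩
    · filter_upwards [Lp.coeFn_smul r p.1, h1] with x hx hx1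
      simp [hx, hx1]
    · rw [schurExpr_eq_diffExpr hA hd (SchwartzMap.smooth _ ⊤)] at h2 ⊢
      filter_upwards [Lp.coeFn_smul r p.2, h2] with x hx hx2
      have h (j : ℕ) : momentumPow j (⇑(r • φ)) x = r * momentumPow j φ x :=
        momentumPow_const_mul j r φ x
      simp only [diffExpr, h, Prod.smul_snd, hx, Pi.smul_apply, hx2, smul_eq_mul, Finset.mul_sum]
      exact Finset.sum_congr rfl fun j _ => by ring

/-- `schurGraph` is the graph of a function. -/
lemma schurGraph_snd_eq_zero (K : MatrixCoeffs) (hA : K.AssumptionA) (lam : ℂ)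
    (hd : lam ∉ closure (Set.range K.d)) (p : L2R × L2R) (hp : p ∈ schurGraph K hA lam hd)
    (h0 : p.1 = 0) : p.2 = 0 := by
  obtain ⟨φ, h1, h2⟩ := hp
  rw [h0] at h1
  have hφ : (φ : ℝ → ℂ) = fun _ => 0 :=
    (Continuous.ae_eq_iff_eq volume φ.continuous continuous_const).1
      (h1.symm.trans (Lp.coeFn_zero ℂ 2 volume))
  rw [schurExpr_eq_diffExpr hA hd (SchwartzMap.smooth _ ⊤)] at h2
  refine Lp.ext (h2.trans (Filter.EventuallyEq.trans (Filter.Eventually.of_forall fun x => ?_)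
    (Lp.coeFn_zero ℂ 2 volume).symm))
  have h (j : ℕ) : momentumPow j φ x = 0 := by
    rw [hφ]
    simpa using momentumPow_const_mul j 0 (fun _ => 0) x
  simp [diffExpr, h]

/-- The operator `S₀(lam)` in `L²(ℝ)`, acting as `φ ↦ τ_S(lam) φ` on Schwartz functions. -/
def schurOp₀ (K : MatrixCoeffs) (hA : K.AssumptionA) (lam : ℂ)
    (hd : lam ∉ closure (Set.range K.d)) : L2R →ₗ.[ℂ] L2R :=
  (schurGraph K hA lam hd).toLinearPMap

lemma mem_graph_schurOp₀ (K : MatrixCoeffs) (hA : K.AssumptionA) (lam : ℂ)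
    (hd : lam ∉ closure (Set.range K.d)) (p : L2R × L2R) :
    p ∈ (schurOp₀ K hA lam hd).graph ↔ ∃ φ : 𝓢(ℝ, ℂ), (p.1 : ℝ → ℂ) =ᵐ[volume] φ ∧
      (p.2 : ℝ → ℂ) =ᵐ[volume] K.schurExpr lam φ := by
  rw [schurOp₀, Submodule.toLinearPMap_graph_eq _ (schurGraph_snd_eq_zero K hA lam hd)]
  rfl

/-- If the coefficients `p_j(·, lam)` are bounded with all their derivatives, the domain of
`S₀(lam)` is the whole Schwartz space. -/
lemma mem_domain_schurOp₀ (K : MatrixCoeffs) (hA : K.AssumptionA) (lam : ℂ)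
    (hd : lam ∉ closure (Set.range K.d)) (hB : ∀ j ≤ K.m, IsBInfty (K.schurCoeff lam j))
    (f : L2R) :
    f ∈ (schurOp₀ K hA lam hd).domain ↔ ∃ φ : 𝓢(ℝ, ℂ), (f : ℝ → ℂ) =ᵐ[volume] φ := by
  rw [LinearPMap.mem_domain_iff]
  simp only [mem_graph_schurOp₀]
  refine ⟨fun ⟨_, φ, h, _⟩ => ⟨φ, h⟩, fun ⟨φ, h⟩ => ?_⟩
  have hmem : MemLp (K.schurExpr lam φ) 2 volume := by
    rw [schurExpr_eq_diffExpr hA hd (SchwartzMap.smooth _ ⊤)]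
    refine memLp_finsetSum _ fun j hj => ?_
    have hj' : j ≤ K.m := by have := Finset.mem_range.1 hj; omega
    obtain ⟨hs, hb⟩ := hB j hj'
    obtain ⟨C, hC⟩ := hb 0
    have hit (i : ℕ) : ∃ ψ : 𝓢(ℝ, ℂ), ⇑ψ = iteratedDeriv i φ := by
      induction i with
      | zero => exact ⟨φ, by simp⟩
      | succ i ih =>
        obtain ⟨ψ, hψ⟩ := ih
        exact ⟨SchwartzMap.derivCLM ℂ ℂ ψ, by
          funext x
          rw [SchwartzMap.derivCLM_apply, hψ, iteratedDeriv_succ]⟩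
    obtain ⟨ψ, hψ⟩ := hit j
    have hm : MemLp (momentumPow j φ) 2 volume := by
      unfold momentumPow
      rw [← hψ]
      exact (ψ.memLp 2 volume).const_mul _
    refine MemLp.of_le_mul (c := C) hm
      (hs.continuous.aestronglyMeasurable.mul hm.aestronglyMeasurable)
      (Filter.Eventually.of_forall fun x => ?_)
    rw [norm_mul]
    exact mul_le_mul_of_nonneg_right (by simpa using hC x) (norm_nonneg _)
  exact ⟨hmem.toLp _, φ, h, hmem.coeFn_toLp⟩

/-- The Schur complement `S(lam)`: the closure of `S₀(lam)`. -/
def schurOp (K : MatrixCoeffs) (hA : K.AssumptionA) (lam : ℂ)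
    (hd : lam ∉ closure (Set.range K.d)) : L2R →ₗ.[ℂ] L2R :=
  (schurOp₀ K hA lam hd).closure

/-! ### Numerical range, resolvent set, sectors -/

/-- The numerical range `{⟨T u, u⟩ : u ∈ Dom T, ‖u‖ = 1}` of an operator in a Hilbert space;
`inner ℂ u (T u)` is linear in `T u`. -/
def numRange {H : Type*} [NormedAddCommGroup H] [InnerProductSpace ℂ H]
    (T : H →ₗ.[ℂ] H) : Set ℂ :=
  {μ | ∃ u : T.domain, ‖(u : H)‖ = 1 ∧ μ = inner ℂ (u : H) (T u)}

/-- The resolvent set: those `w` for which `T - w` is a bijection from `Dom T` onto the space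
with bounded inverse. -/
def resolventSetPMap {H : Type*} [NormedAddCommGroup H] [InnerProductSpace ℂ H]
    (T : H →ₗ.[ℂ] H) : Set ℂ :=
  {w | ∃ R : H →L[ℂ] H,
    (∀ f : H, ∃ u : T.domain, (u : H) = R f ∧ T u - w • (u : H) = f) ∧
    ∀ u : T.domain, R (T u - w • (u : H)) = u}

/-- The closed sector with vertex `z₀`, semi-angle `ϑ` and axis of direction `exp (i ψ)`. -/
def closedSector (z₀ : ℂ) (ψ ϑ : ℝ) : Set ℂ :=
  {z | ∃ r t : ℝ, 0 ≤ r ∧ |t| ≤ ϑ ∧ z = z₀ + r * Complex.exp ((ψ + t : ℝ) * Complex.I)}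

end

/-! On Schwartz functions the Schur complement is `P = ∑ p_j D^j` with coefficients in `B^∞`, of
even order `2l`, and for `e = exp (iθ)` the leading coefficient of `eP` has real part at least `δ >
0`. Moving `l` of the derivatives to the other side of `⟨φ, ePφ⟩` produces `⟨D^l φ, e p_m D^l φ⟩`
plus terms of lower order, and interpolation makes these small relative to `‖D^l φ‖²`. Hence
Gårding's inequality `Re ⟨φ, ePφ⟩ ≥ (δ/2) ‖D^l φ‖² - C ‖φ‖²` (`exists_le_re_inner`) and the upper
bound `|⟨φ, ePφ⟩| ≤ C' (‖D^l φ‖² + ‖φ‖²)` (`exists_norm_inner_le`). Comparing the two puts the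
numerical range on the core in a sector, and taking the closure of the operator does not change the
closure of its numerical range (`closure_numRange_eq`).

For `μ` off that closed set, `P - μ` is bounded below by the distance, so only density of its range
remains (`mem_resolventSetPMap_of_core`). Density is carried along two segments of operators by
`dense_range_of_continuity_method`, which needs just a uniform a priori estimate on the segment, so
neither the domain of the closure nor the adjoint has to be identified.

The first segment joins `(1 - (2π)⁻² d²/dx²)^l`, which the Fourier transform shows to be onto the
Schwartz space, to `eP + R` with `R` large (`exists_coercive_and_dense_range`). The second joins `eP
+ R` to a multiple `we(P - μ)` (`dense_range_sub_of_notMem_closure_formRange`). Here convexity of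
the numerical range (`convex_formRange`) supplies a half-plane separating it from `μ`, and the
sector permits a choice of normal with `w` off the negative half-axis, so that the coefficient of
`P` never vanishes on the segment. -/

noncomputable section

/-! ### Numerical ranges of operators given on a core -/

section Core

variable {V H : Type*} [AddCommGroup V] [Module ℂ V] [NormedAddCommGroup H] [InnerProductSpace ℂ H]

/-- The numerical range of the operator `J u ↦ A u`. -/
def formRange (J A : V →ₗ[ℂ] H) : Set ℂ :=
  {z | ∃ u : V, ‖J u‖ = 1 ∧ z = inner ℂ (J u) (A u)}

lemma exists_mem_formRange (J A : V →ₗ[ℂ] H) {u : V} (hu : J u ≠ 0) :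
    ∃ z ∈ formRange J A, inner ℂ (J u) (A u) = z * (‖J u‖ : ℂ) ^ 2 := by
  have h0 : ‖J u‖ ≠ 0 := norm_ne_zero_iff.2 hu
  have h0' : (‖J u‖ : ℂ) ≠ 0 := by exact_mod_cast h0
  refine ⟨_, ⟨((‖J u‖ : ℂ)⁻¹) • u, ?_, rfl⟩, ?_⟩
  · rw [map_smul, norm_smul, norm_inv, Complex.norm_real, norm_norm, inv_mul_cancel₀ h0]
  · rw [map_smul, map_smul, inner_smul_left, inner_smul_right, map_inv₀, Complex.conj_ofReal]
    field_simp

/-- The Toeplitz–Hausdorff theorem. -/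
theorem convex_formRange (J A : V →ₗ[ℂ] H) (hJ : Function.Injective J) :
    Convex ℝ (formRange J A) := by
  rintro a ⟨φ, hφ, ha⟩ b ⟨ψ, hψ, hb⟩ s t hs ht hst
  by_cases hab : a = b
  · subst hab
    rw [← add_smul, hst, one_smul]
    exact ⟨φ, hφ, ha⟩
  have hba : b - a ≠ 0 := sub_ne_zero.2 (Ne.symm hab)
  -- This affine change of the form sends `a` to `0` and `b` to `1`, so it remains to attain the
  -- value `t`.
  let h : V → V → ℂ := fun u v => (inner ℂ (J u) (A v) - a * inner ℂ (J u) (J v)) / (b - a)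
  have hφφ : h φ φ = 0 := by
    simp only [h, inner_self_eq_norm_sq_to_K, hφ, ← ha]; simp
  have hψψ : h ψ ψ = 1 := by
    simp only [h, inner_self_eq_norm_sq_to_K, hψ, ← hb]; simp [hba]
  have hadd_left (u v w) : h (u + v) w = h u w + h v w := by
    simp only [h, map_add, inner_add_left]; ring
  have hadd_right (u v w) : h u (v + w) = h u v + h u w := by
    simp only [h, map_add, inner_add_right]; ring
  have hsmul_left (c : ℂ) (u v) : h (c • u) v = (starRingEnd ℂ) c * h u v := by
    simp only [h, map_smul, inner_smul_left]; ring
  have hsmul_right (c : ℂ) (u v) : h u (c • v) = c * h u v := by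
    simp only [h, map_smul, inner_smul_right]; ring
  -- Rescaling `φ` by `c` makes the sum of the cross terms real. The imaginary part equals that of
  -- `c * (h ψ φ - conj (h φ ψ))`, so the conjugate of the second factor works unless it is zero.
  obtain ⟨c, hc, hcim⟩ : ∃ c : ℂ, c ≠ 0 ∧
      ((starRingEnd ℂ) c * h φ ψ + c * h ψ φ).im = 0 := by
    by_cases hz : h ψ φ = (starRingEnd ℂ) (h φ ψ)
    · refine ⟨1, one_ne_zero, ?_⟩
      rw [hz]; simp
    · refine ⟨(starRingEnd ℂ) (h ψ φ - (starRingEnd ℂ) (h φ ψ)), ?_, ?_⟩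
      · exact (map_ne_zero _).2 (sub_ne_zero.2 hz)
      · simp; ring
  let z : ℝ → V := fun r => ((1 - r : ℝ) : ℂ) • (c • φ) + (r : ℂ) • ψ
  -- The path avoids zero because `ψ` cannot be a multiple of `φ`: the form vanishes at `φ` but not
  -- at `ψ`.
  have hzne (r : ℝ) : z r ≠ 0 := by
    intro hz
    by_cases hr : r = 0
    · subst hr
      have hφ0 : φ = 0 := by simpa [z, hc] using hz
      simp [hφ0] at hφ
    · have hr' : (r : ℂ) ≠ 0 := by exact_mod_cast hr
      have e : ψ = (-(r : ℂ)⁻¹ * (1 - r : ℝ) * c) • φ := by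
        have e1 : (r : ℂ) • ψ = -(((1 - r : ℝ) : ℂ) • (c • φ)) := by
          rw [eq_neg_iff_add_eq_zero, add_comm]; exact hz
        calc ψ = (r : ℂ)⁻¹ • ((r : ℂ) • ψ) := by rw [smul_smul, inv_mul_cancel₀ hr', one_smul]
          _ = _ := by rw [e1, smul_neg, smul_smul, smul_smul, ← neg_smul]; congr 1; ring
      rw [e, hsmul_left, hsmul_right, hφφ] at hψψ
      simp at hψψ
  have hJz (r : ℝ) : ‖J (z r)‖ ≠ 0 := fun h0 =>
    hzne r (hJ (by rw [norm_eq_zero.1 h0, map_zero]))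
  have hhz (r : ℝ) : h (z r) (z r) =
      (r : ℂ) ^ 2 + (r * (1 - r) : ℝ) * ((starRingEnd ℂ) c * h φ ψ + c * h ψ φ) := by
    simp only [z, hadd_left, hadd_right, hsmul_left, hsmul_right, hφφ, hψψ, Complex.conj_ofReal]
    push_cast
    ring
  have him (r : ℝ) : (h (z r) (z r)).im = 0 := by
    rw [hhz, Complex.add_im, Complex.im_ofReal_mul, hcim, ← Complex.ofReal_pow,
      Complex.ofReal_im]
    simp
  have hJc : Continuous fun r => J (z r) := by
    simp only [z, map_add, map_smul]
    fun_prop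
  -- The Rayleigh quotient along the path is real and runs from `0` to `1`; the intermediate value
  -- theorem gives `t`.
  have hcont : Continuous fun r => (h (z r) (z r)).re / ‖J (z r)‖ ^ 2 := by
    refine Continuous.div ?_ (hJc.norm.pow 2) fun r => pow_ne_zero 2 (hJz r)
    simp only [hhz]
    fun_prop
  have h0 : (h (z 0) (z 0)).re / ‖J (z 0)‖ ^ 2 = 0 := by rw [hhz]; simp
  have h1 : (h (z 1) (z 1)).re / ‖J (z 1)‖ ^ 2 = 1 := by
    have : z 1 = ψ := by simp [z]
    rw [this, hψψ, hψ]; simp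
  obtain ⟨r, -, hr⟩ := intermediate_value_Icc (zero_le_one' ℝ) hcont.continuousOn
    (show t ∈ Set.Icc _ _ by rw [h0, h1]; exact ⟨ht, by linarith⟩)
  obtain ⟨y, hy, hyz⟩ := exists_mem_formRange J A (norm_ne_zero_iff.1 (hJz r))
  have hJz' : (‖J (z r)‖ : ℂ) ≠ 0 := by exact_mod_cast hJz r
  have hval : h (z r) (z r) = t * (‖J (z r)‖ : ℂ) ^ 2 := by
    apply Complex.ext
    · rw [← hr, ← Complex.ofReal_pow, ← Complex.ofReal_mul, Complex.ofReal_re]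
      have := hJz r
      field_simp
    · rw [him, ← Complex.ofReal_pow, ← Complex.ofReal_mul, Complex.ofReal_im]
  have hya : y = a + t * (b - a) := by
    have e : (y - a) * (‖J (z r)‖ : ℂ) ^ 2 = (b - a) * t * (‖J (z r)‖ : ℂ) ^ 2 := by
      simp only [h, hyz, inner_self_eq_norm_sq_to_K, div_eq_iff hba] at hval
      have hval' : y * (‖J (z r)‖ : ℂ) ^ 2 - a * (‖J (z r)‖ : ℂ) ^ 2 =
        t * (‖J (z r)‖ : ℂ) ^ 2 * (b - a) := hval
      linear_combination hval'
    have := mul_right_cancel₀ (pow_ne_zero 2 hJz') e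
    linear_combination this
  have hs' : s = 1 - t := by linarith
  convert hy using 1
  rw [hya, hs', Complex.real_smul, Complex.real_smul]
  push_cast
  ring

/-- A point outside the closed convex hull is strictly separated from the set. -/
lemma exists_halfplane_separating {W : Set ℂ} (hW : Convex ℝ W) {μ : ℂ} (hμ : μ ∉ closure W) :
    ∃ w : ℂ, w ≠ 0 ∧ ∃ ε > (0 : ℝ), ∀ z ∈ W, ε ≤ (w * (z - μ)).re := by
  rcases W.eq_empty_or_nonempty with rfl | ⟨z₁, hz₁⟩
  · exact ⟨1, one_ne_zero, 1, one_pos, by simp⟩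
  obtain ⟨f, u, hu, hf⟩ := geometric_hahn_banach_point_closed hW.closure isClosed_closure hμ
  -- Every real-linear functional on `ℂ` is the real part of multiplication by a complex number.
  have hfw (z : ℂ) : f z = (((f 1 : ℂ) - f Complex.I * Complex.I) * z).re := by
    have e : z = z.re • (1 : ℂ) + z.im • Complex.I := by
      simp [Complex.real_smul, Complex.re_add_im]
    conv_lhs => rw [e, map_add, map_smul, map_smul]
    simp
    ring
  have hsep : ∀ z ∈ W, u - f μ ≤ (((f 1 : ℂ) - f Complex.I * Complex.I) * (z - μ)).re := by
    intro z hz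
    rw [← hfw, map_sub]
    linarith [hf z (subset_closure hz)]
  refine ⟨_, fun h0 => ?_, u - f μ, by linarith, hsep⟩
  have := hsep z₁ hz₁
  rw [h0] at this
  simp at this
  linarith

/-- The method of continuity for operators with dense range. -/
theorem dense_range_of_continuity_method [CompleteSpace H] (B₀ B₁ : V →ₗ[ℂ] H) (K : ℝ)
    (hK : ∀ s ∈ Set.Icc (0 : ℝ) 1, ∀ u,
      ‖B₁ u - B₀ u‖ ≤ K * ‖((1 - s : ℝ) : ℂ) • B₀ u + (s : ℂ) • B₁ u‖)
    (h₁ : Dense (Set.range B₁)) : Dense (Set.range B₀) := by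
  let B : ℝ → V →ₗ[ℂ] H := fun s => ((1 - s : ℝ) : ℂ) • B₀ + (s : ℂ) • B₁
  have hB (s : ℝ) (u : V) : B s u = ((1 - s : ℝ) : ℂ) • B₀ u + (s : ℂ) • B₁ u := rfl
  have hBsub (s t : ℝ) (u : V) : B t u - B s u = ((t - s : ℝ) : ℂ) • (B₁ u - B₀ u) := by
    simp only [hB]
    push_cast
    module
  have hdense (L : V →ₗ[ℂ] H) :
      Dense (Set.range L) ↔ ∀ v : H, (∀ u, inner ℂ (L u) v = 0) → v = 0 := by
    have e : Set.range L = (LinearMap.range L : Set H) := (LinearMap.coe_range L).symm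
    rw [e, Submodule.dense_iff_topologicalClosure_eq_top,
      Submodule.topologicalClosure_eq_top_iff, Submodule.eq_bot_iff]
    refine forall_congr' fun v => ?_
    rw [Submodule.mem_orthogonal]
    simp
  -- A vector `v` orthogonal to the range of `B s` is nearly orthogonal to that of `B t`. As the
  -- latter is dense, the estimate applies to `v` itself and forces `v = 0`.
  have step (s t : ℝ) (ht : t ∈ Set.Icc (0 : ℝ) 1) (hst : |t - s| * K < 1)
      (hd : Dense (Set.range (B t))) : Dense (Set.range (B s)) := by
    rw [hdense]
    intro v hv
    have key : ∀ x : H, ‖inner ℂ x v‖ ≤ |t - s| * K * ‖x‖ * ‖v‖ := by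
      intro x
      refine hd.induction (P := fun x => ‖inner ℂ x v‖ ≤ |t - s| * K * ‖x‖ * ‖v‖) ?_
        (isClosed_le (by fun_prop) (by fun_prop)) x
      rintro _ ⟨u, rfl⟩
      have e : inner ℂ (B t u) v = inner ℂ (B t u - B s u) v := by
        rw [inner_sub_left, hv, sub_zero]
      rw [e]
      refine (norm_inner_le_norm _ _).trans (mul_le_mul_of_nonneg_right ?_ (norm_nonneg _))
      rw [hBsub, norm_smul, Complex.norm_real, Real.norm_eq_abs, mul_assoc]
      exact mul_le_mul_of_nonneg_left (hK t ht u) (abs_nonneg _)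
    have := key v
    rw [inner_self_eq_norm_sq_to_K, norm_pow] at this
    have h2 : ‖v‖ ^ 2 ≤ |t - s| * K * ‖v‖ ^ 2 := by
      simpa [pow_two, mul_assoc] using this
    by_contra hv0
    have : 0 < ‖v‖ ^ 2 := by positivity
    nlinarith
  -- Steps of length `1 / n` with `K < n` lead from `s = 1` down to `s = 0`.
  obtain ⟨n, hn⟩ := exists_nat_gt (max K 0)
  have hn0 : (0 : ℝ) < n := lt_of_le_of_lt (le_max_right _ _) hn
  have hind : ∀ i ≤ n, Dense (Set.range (B (1 - i / n))) := by
    intro i hi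
    induction i with
    | zero => simpa [B] using h₁
    | succ i ih =>
      refine step _ (1 - i / n) ⟨?_, ?_⟩ ?_ (ih (by omega))
      · rw [sub_nonneg, div_le_one hn0]; exact_mod_cast (by omega : i ≤ n)
      · have : (0 : ℝ) ≤ i / n := by positivity
        linarith
      · have e : (1 - (i : ℝ) / n) - (1 - ((i + 1 : ℕ) : ℝ) / n) = 1 / n := by
          push_cast; field_simp; ring
        rw [e, abs_of_pos (by positivity), one_div_mul_eq_div, div_lt_one hn0]
        exact lt_of_le_of_lt (le_max_left _ _) hn
  have := hind n le_rfl
  rw [div_self hn0.ne'] at this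
  simpa [B] using this

/-- If a set lies in a sector around the positive half-axis, a point outside its closed convex hull
can be separated from it by a half-plane whose inner normal is not the negative half-axis. -/
lemma exists_halfplane_slitPlane {W : Set ℂ} (hW : Convex ℝ W) {e : ℂ} (he : ‖e‖ = 1) {M C : ℝ}
    (hM : 0 ≤ M) (hsec : ∀ z ∈ W, |(e * z).im| ≤ M * ((e * z).re + C)) {μ : ℂ}
    (hμ : μ ∉ closure W) :
    ∃ w ∈ Complex.slitPlane, ∃ ε > (0 : ℝ), ∀ z ∈ W, ε ≤ (w * e * (z - μ)).re := by
  have he0 : e ≠ 0 := norm_ne_zero_iff.1 (by rw [he]; exact one_ne_zero)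
  obtain ⟨w₀, hw₀, ε, hε, hsep⟩ := exists_halfplane_separating hW hμ
  obtain ⟨w, rfl⟩ : ∃ w, w₀ = w * e := ⟨w₀ / e, by field_simp⟩
  by_cases hw : w ∈ Complex.slitPlane
  · exact ⟨w, hw, ε, hε, hsep⟩
  -- In the exceptional case `w < 0` the half-plane bounds `Re (e z)` above on `W`. The sector then
  -- bounds `Im (e z)`, so a slight tilt of `w` costs at most `ε / 2`.
  rw [Complex.mem_slitPlane_iff, not_or, not_lt, not_not] at hw
  have hwre : w.re < 0 := lt_of_le_of_ne hw.1 fun h0 =>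
    hw₀ (by rw [Complex.ext (z := w) (w := 0) h0 hw.2, zero_mul])
  set L : ℝ := M * ((e * μ).re + C) + |(e * μ).im| with hL
  have him : ∀ z ∈ W, |(e * (z - μ)).im| ≤ |L| := by
    intro z hz
    have h1 := hsep z hz
    have h2 : (w * e * (z - μ)).re = w.re * ((e * z).re - (e * μ).re) := by
      rw [mul_assoc, Complex.mul_re, hw.2, mul_sub, Complex.sub_re]; ring
    have h3 : (e * z).re ≤ (e * μ).re := by rw [h2] at h1; nlinarith
    have h4 := hsec z hz
    have h5 : M * ((e * z).re + C) ≤ M * ((e * μ).re + C) := by gcongr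
    rw [mul_sub, Complex.sub_im]
    calc |(e * z).im - (e * μ).im| ≤ |(e * z).im| + |(e * μ).im| := abs_sub _ _
      _ ≤ L := by rw [hL]; linarith
      _ ≤ |L| := le_abs_self _
  set η : ℝ := ε / (2 * (|L| + 1)) with hη
  have hη0 : 0 < η := by positivity
  refine ⟨w + η * Complex.I, ?_, ε / 2, by positivity, fun z hz => ?_⟩
  · rw [Complex.mem_slitPlane_iff]
    right
    simp [hw.2, hη0.ne']
  · have e1 : ((w + η * Complex.I) * e * (z - μ)).re =
        (w * e * (z - μ)).re - η * (e * (z - μ)).im := by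
      rw [add_mul, add_mul, Complex.add_re, mul_assoc (_ * Complex.I), mul_assoc (η : ℂ),
        Complex.re_ofReal_mul, Complex.I_mul_re]
      ring
    have e2 : η * (e * (z - μ)).im ≤ ε / 2 := by
      calc η * (e * (z - μ)).im ≤ η * (|L| + 1) := by
            gcongr
            linarith [le_abs_self (e * (z - μ)).im, him z hz]
        _ = ε / 2 := by rw [hη]; field_simp
    rw [e1]
    linarith [hsep z hz]

/-- By Cauchy–Schwarz. Lower bounds on real parts of forms survive convex combinations, so this
yields the a priori estimates along the segments. -/
lemma mul_norm_le_of_re_inner {x y : H} {ε : ℝ} (h : ε * ‖x‖ ^ 2 ≤ (inner ℂ x y).re) :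
    ε * ‖x‖ ≤ ‖y‖ := by
  rcases eq_or_ne x 0 with rfl | hx
  · simp
  have h1 : (inner ℂ x y).re ≤ ‖x‖ * ‖y‖ := (Complex.re_le_norm _).trans (norm_inner_le_norm x y)
  have h2 : 0 < ‖x‖ := norm_pos_iff.2 hx
  nlinarith

/-- The segment from `w` to `1` is compact and misses `0`, since `w` is off the closed negative
half-axis. -/
lemma exists_forall_le_norm_segment {w : ℂ} (hw : w ∈ Complex.slitPlane) :
    ∃ κ > (0 : ℝ), ∀ s ∈ Set.Icc (0 : ℝ) 1, κ ≤ ‖((1 - s : ℝ) : ℂ) * w + s‖ := by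
  obtain ⟨s₀, hs₀, hmin⟩ := isCompact_Icc.exists_isMinOn (Set.nonempty_Icc.2 (zero_le_one' ℝ))
    (f := fun s : ℝ => ‖((1 - s : ℝ) : ℂ) * w + s‖) (by fun_prop)
  refine ⟨_, norm_pos_iff.2 fun h0 => ?_, fun s hs => hmin hs⟩
  have hre : (1 - s₀) * w.re + s₀ = 0 := by simpa using congrArg Complex.re h0
  have him : (1 - s₀) * w.im = 0 := by simpa using congrArg Complex.im h0
  rcases Complex.mem_slitPlane_iff.1 hw with h | h
  · have h1 : 0 ≤ (1 - s₀) * w.re := mul_nonneg (by linarith [hs₀.2]) h.le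
    have h2 : s₀ = 0 := le_antisymm (by linarith) hs₀.1
    rw [h2] at hre
    linarith
  · have : 1 - s₀ = 0 := (mul_eq_zero.1 him).resolve_right h
    rw [this] at hre
    linarith

/-- Off the closed numerical range, `A - μ` is bounded below. -/
lemma exists_lower_bound_of_notMem_closure_formRange (J A : V →ₗ[ℂ] H)
    {μ : ℂ} (hμ : μ ∉ closure (formRange J A)) :
    ∃ ε > (0 : ℝ), ∀ u, ε * ‖J u‖ ≤ ‖A u - μ • J u‖ := by
  obtain ⟨ε, hε, hb⟩ := Metric.isOpen_iff.1 isClosed_closure.isOpen_compl μ hμ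
  refine ⟨ε, hε, fun u => ?_⟩
  by_cases hu : J u = 0
  · simp [hu]
  obtain ⟨z, hz, hzu⟩ := exists_mem_formRange J A hu
  have hd : ε ≤ ‖z - μ‖ := by
    by_contra hlt
    exact hb (by rw [Metric.mem_ball, dist_eq_norm]; linarith) (subset_closure hz)
  have h1 : inner ℂ (J u) (A u - μ • J u) = (z - μ) * (‖J u‖ : ℂ) ^ 2 := by
    rw [inner_sub_right, inner_smul_right, hzu, inner_self_eq_norm_sq_to_K]
    simp only [Complex.coe_algebraMap]
    ring
  have h2 := norm_inner_le_norm (𝕜 := ℂ) (J u) (A u - μ • J u)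
  rw [h1, norm_mul, norm_pow, Complex.norm_real, norm_norm] at h2
  have h3 : 0 < ‖J u‖ := norm_pos_iff.2 hu
  nlinarith [mul_le_mul_of_nonneg_right hd (sq_nonneg ‖J u‖)]

/-- For an operator with numerical range in a sector, `A - μ` has dense range for every `μ` off
the closed numerical range as soon as this is the case for one `μ` far from the sector. -/
theorem dense_range_sub_of_notMem_closure_formRange [CompleteSpace H] (J A : V →ₗ[ℂ] H)
    (hJ : Function.Injective J) {e : ℂ} (he : ‖e‖ = 1) {M C : ℝ} (hM : 0 ≤ M)
    (hsec : ∀ z ∈ formRange J A, |(e * z).im| ≤ M * ((e * z).re + C)) {R : ℝ}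
    (hR : ∀ u, ‖J u‖ ^ 2 ≤ (inner ℂ (J u) (e • A u + (R : ℂ) • J u)).re)
    (hdense : Dense (Set.range (e • A + (R : ℂ) • J))) {μ : ℂ}
    (hμ : μ ∉ closure (formRange J A)) :
    Dense (Set.range (A - μ • J)) := by
  have he0 : e ≠ 0 := norm_ne_zero_iff.1 (by rw [he]; exact one_ne_zero)
  obtain ⟨w, hw, ε, hε, hsep⟩ :=
    exists_halfplane_slitPlane (convex_formRange J A hJ) he hM hsec hμ
  obtain ⟨κ, hκ, hκs⟩ := exists_forall_le_norm_segment hw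
  have hw0 : w ≠ 0 := Complex.slitPlane_ne_zero hw
  set B₀ : V →ₗ[ℂ] H := (w * e) • (A - μ • J) with hB₀
  set B₁ : V →ₗ[ℂ] H := e • A + (R : ℂ) • J with hB₁
  have hsep' (u : V) : ε * ‖J u‖ ^ 2 ≤ (inner ℂ (J u) (B₀ u)).re := by
    by_cases hu : J u = 0
    · simp [hu]
    obtain ⟨z, hz, hzu⟩ := exists_mem_formRange J A hu
    have h1 : inner ℂ (J u) (B₀ u) = ((‖J u‖ ^ 2 : ℝ) : ℂ) * (w * e * (z - μ)) := by
      simp only [hB₀, LinearMap.smul_apply, LinearMap.sub_apply, inner_smul_right,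
        inner_sub_right, hzu, inner_self_eq_norm_sq_to_K, Complex.coe_algebraMap]
      push_cast
      ring
    rw [h1, Complex.re_ofReal_mul, mul_comm]
    exact mul_le_mul_of_nonneg_left (hsep z hz) (sq_nonneg _)
  set ν : ℝ := min ε 1 with hν
  have hν0 : 0 < ν := lt_min hε one_pos
  have hJle : ∀ s ∈ Set.Icc (0 : ℝ) 1, ∀ u,
      ν * ‖J u‖ ≤ ‖((1 - s : ℝ) : ℂ) • B₀ u + (s : ℂ) • B₁ u‖ := by
    intro s hs u
    refine mul_norm_le_of_re_inner ?_
    rw [inner_add_right, inner_smul_right, inner_smul_right, Complex.add_re,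
      Complex.re_ofReal_mul, Complex.re_ofReal_mul]
    have h1 := hsep' u
    have h2 : ‖J u‖ ^ 2 ≤ (inner ℂ (J u) (B₁ u)).re := hR u
    have h3 : ν * ‖J u‖ ^ 2 ≤ ε * ‖J u‖ ^ 2 := by gcongr; exact min_le_left _ _
    have h4 : ν * ‖J u‖ ^ 2 ≤ 1 * ‖J u‖ ^ 2 := by gcongr; exact min_le_right _ _
    nlinarith [hs.1, hs.2]
  set c : ℝ := ‖w * e * μ‖ + |R| with hc
  have hc0 : 0 ≤ c := by positivity
  -- The coefficient of `A u` in the combination is `((1 - s) w + s) e`, of modulus at least `κ`;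
  -- the multiple of `J u` left over is controlled by `hJle`.
  have hAle : ∀ s ∈ Set.Icc (0 : ℝ) 1, ∀ u,
      κ * ‖A u‖ ≤ (1 + c / ν) * ‖((1 - s : ℝ) : ℂ) • B₀ u + (s : ℂ) • B₁ u‖ := by
    intro s hs u
    set X := ((1 - s : ℝ) : ℂ) • B₀ u + (s : ℂ) • B₁ u with hX
    have e1 : ((((1 - s : ℝ) : ℂ) * w + s) * e) • A u =
        X + (((1 - s : ℝ) : ℂ) * (w * e * μ) - s * R) • J u := by
      simp only [hX, hB₀, hB₁, LinearMap.smul_apply, LinearMap.sub_apply, LinearMap.add_apply]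
      module
    have e2 : κ * ‖A u‖ ≤ ‖X‖ + c * ‖J u‖ := by
      calc κ * ‖A u‖ ≤ ‖((((1 - s : ℝ) : ℂ) * w + s) * e) • A u‖ := by
            rw [norm_smul, norm_mul, he, mul_one]
            exact mul_le_mul_of_nonneg_right (hκs s hs) (norm_nonneg _)
        _ ≤ ‖X‖ + ‖((1 - s : ℝ) : ℂ) * (w * e * μ) - s * R‖ * ‖J u‖ := by
            rw [e1, ← norm_smul]; exact norm_add_le _ _
        _ ≤ ‖X‖ + c * ‖J u‖ := by
            gcongr
            refine (norm_sub_le _ _).trans ?_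
            rw [norm_mul, norm_mul (s : ℂ), Complex.norm_real, Complex.norm_real,
              Complex.norm_real, Real.norm_eq_abs, Real.norm_eq_abs, Real.norm_eq_abs,
              abs_of_nonneg hs.1, abs_of_nonneg (by linarith [hs.2] : (0 : ℝ) ≤ 1 - s), hc]
            nlinarith [hs.1, hs.2, norm_nonneg (w * e * μ), abs_nonneg R]
    have e3 : ‖J u‖ ≤ ‖X‖ / ν := by rw [le_div_iff₀ hν0, mul_comm]; exact hJle s hs u
    calc κ * ‖A u‖ ≤ ‖X‖ + c * (‖X‖ / ν) := e2.trans (by gcongr)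
      _ = _ := by ring
  have key := dense_range_of_continuity_method B₀ B₁
    (‖e - w * e‖ * ((1 + c / ν) / κ) + ‖(R : ℂ) + w * e * μ‖ / ν) (fun s hs u => ?_) hdense
  · have e1 : A - μ • J = (w * e)⁻¹ • B₀ := by
      rw [hB₀, smul_smul, inv_mul_cancel₀ (mul_ne_zero hw0 he0), one_smul]
    have e2 : Set.range (A - μ • J) = Set.range B₀ := by
      rw [e1]
      ext v
      constructor
      · rintro ⟨u, rfl⟩
        exact ⟨(w * e)⁻¹ • u, by rw [map_smul]; rfl⟩
      · rintro ⟨u, rfl⟩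
        refine ⟨(w * e) • u, ?_⟩
        rw [LinearMap.smul_apply, map_smul, smul_smul,
          inv_mul_cancel₀ (mul_ne_zero hw0 he0), one_smul]
    rw [e2]
    exact key
  · set X := ((1 - s : ℝ) : ℂ) • B₀ u + (s : ℂ) • B₁ u with hX
    have e1 : B₁ u - B₀ u = (e - w * e) • A u + ((R : ℂ) + w * e * μ) • J u := by
      simp only [hB₀, hB₁, LinearMap.smul_apply, LinearMap.sub_apply, LinearMap.add_apply]
      module
    have e2 : ‖A u‖ ≤ (1 + c / ν) / κ * ‖X‖ := by
      rw [div_mul_eq_mul_div, le_div_iff₀ hκ, mul_comm]; exact hAle s hs u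
    have e3 : ‖J u‖ ≤ ‖X‖ / ν := by rw [le_div_iff₀ hν0, mul_comm]; exact hJle s hs u
    calc ‖B₁ u - B₀ u‖ ≤ ‖e - w * e‖ * ‖A u‖ + ‖(R : ℂ) + w * e * μ‖ * ‖J u‖ := by
          rw [e1, ← norm_smul, ← norm_smul]; exact norm_add_le _ _
      _ ≤ ‖e - w * e‖ * ((1 + c / ν) / κ * ‖X‖) + ‖(R : ℂ) + w * e * μ‖ * (‖X‖ / ν) := by gcongr
      _ = _ := by ring

/-! ### Closed operators with a given core -/

variable {J A : V →ₗ[ℂ] H} {T : H →ₗ.[ℂ] H}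

lemma apply_eq_of_mem_closure_core
    (hT : (T.graph : Set (H × H)) = closure (Set.range fun u => (J u, A u))) {x y : H}
    (hxy : (x, y) ∈ closure (Set.range fun u => (J u, A u))) :
    ∃ u : T.domain, (u : H) = x ∧ T u = y := by
  rw [← hT, SetLike.mem_coe, LinearPMap.mem_graph_iff] at hxy
  simpa using hxy

lemma mem_closure_core
    (hT : (T.graph : Set (H × H)) = closure (Set.range fun u => (J u, A u))) (u : T.domain) :
    ((u : H), T u) ∈ closure (Set.range fun u => (J u, A u)) := by
  rw [← hT]
  exact T.mem_graph u

/-- The numerical range of a closed operator has the same closure as that on a core. -/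
theorem closure_numRange_eq
    (hT : (T.graph : Set (H × H)) = closure (Set.range fun u => (J u, A u))) :
    closure (numRange T) = closure (formRange J A) := by
  refine subset_antisymm (closure_minimal ?_ isClosed_closure) (closure_mono ?_)
  · rintro _ ⟨u, hu, rfl⟩
    have hg := mem_closure_core hT u
    rw [mem_closure_iff_seq_limit] at hg
    obtain ⟨p, hp, hlim⟩ := hg
    choose φ hφ using hp
    have h1 : Filter.Tendsto (fun n => (p n).1) Filter.atTop (nhds (u : H)) :=
      (continuous_fst.tendsto _).comp hlim
    have h2 : Filter.Tendsto (fun n => (p n).2) Filter.atTop (nhds (T u)) :=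
      (continuous_snd.tendsto _).comp hlim
    -- Core approximants need not be unit vectors, hence Rayleigh quotients.
    have h3 : Filter.Tendsto (fun n => inner ℂ (p n).1 (p n).2 / (‖(p n).1‖ : ℂ) ^ 2) Filter.atTop
        (nhds (inner ℂ (u : H) (T u) / (‖(u : H)‖ : ℂ) ^ 2)) := by
      refine (h1.inner h2).div ?_ (by simp [hu])
      exact ((Complex.continuous_ofReal.tendsto _).comp h1.norm).pow 2
    rw [hu, Complex.ofReal_one, one_pow, div_one] at h3
    refine mem_closure_of_tendsto h3 ?_
    have h4 : ∀ᶠ n in Filter.atTop, ‖(p n).1‖ ≠ 0 :=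
      h1.norm.eventually_ne (by rw [hu]; exact one_ne_zero)
    filter_upwards [h4] with n hn
    have e1 : (p n).1 = J (φ n) := by rw [← hφ n]
    have e2 : (p n).2 = A (φ n) := by rw [← hφ n]
    rw [e1] at hn ⊢
    rw [e2]
    obtain ⟨z, hz, hzu⟩ := exists_mem_formRange J A (norm_ne_zero_iff.1 hn)
    have hn' : (‖J (φ n)‖ : ℂ) ^ 2 ≠ 0 := pow_ne_zero 2 (by exact_mod_cast hn)
    rwa [hzu, mul_div_assoc, div_self hn', mul_one]
  · rintro _ ⟨φ, hφ, rfl⟩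
    obtain ⟨u, hu1, hu2⟩ := apply_eq_of_mem_closure_core hT (x := J φ) (y := A φ)
      (subset_closure ⟨φ, rfl⟩)
    exact ⟨u, by rw [hu1, hφ], by rw [hu1, hu2]⟩

/-- If `A - μ` is bounded below and has dense range on a core, then `μ` is in the resolvent set. -/
theorem mem_resolventSetPMap_of_core [CompleteSpace H]
    (hT : (T.graph : Set (H × H)) = closure (Set.range fun u => (J u, A u))) {μ : ℂ} {ε : ℝ}
    (hε : 0 < ε) (hlow : ∀ u, ε * ‖J u‖ ≤ ‖A u - μ • J u‖)
    (hdense : Dense (Set.range (A - μ • J))) : μ ∈ resolventSetPMap T := by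
  have hlowT (u : T.domain) : ε * ‖(u : H)‖ ≤ ‖T u - μ • (u : H)‖ := by
    have hcl : IsClosed {p : H × H | ε * ‖p.1‖ ≤ ‖p.2 - μ • p.1‖} :=
      isClosed_le (by fun_prop) (by fun_prop)
    exact closure_minimal (by rintro _ ⟨φ, rfl⟩; exact hlow φ) hcl (mem_closure_core hT u)
  have hinj (u v : T.domain) (h : T u - μ • (u : H) = T v - μ • (v : H)) : u = v := by
    have h1 := hlowT (u - v)
    have h2 : T (u - v) - μ • ((u - v : T.domain) : H) = 0 := by
      rw [LinearPMap.map_sub, Submodule.coe_sub, smul_sub, sub_sub_sub_comm, h, sub_self]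
    rw [h2, norm_zero] at h1
    have h3 : ‖((u - v : T.domain) : H)‖ = 0 := by
      have := norm_nonneg ((u - v : T.domain) : H)
      nlinarith
    exact sub_eq_zero.1 (Subtype.ext (norm_eq_zero.1 h3))
  have hsurj (f : H) : ∃ u : T.domain, T u - μ • (u : H) = f := by
    have hf := hdense f
    rw [mem_closure_iff_seq_limit] at hf
    obtain ⟨g, hg, hlim⟩ := hf
    choose φ hφ using hg
    have hφ' (n : ℕ) : A (φ n) - μ • J (φ n) = g n := hφ n
    -- The lower bound turns convergence of `(A - μ J) φ n` into convergence of `J (φ n)`, hence of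
    -- `A (φ n)`; the limit pair lies in the closed graph.
    have hcau : CauchySeq fun n => J (φ n) := by
      have hgc := hlim.cauchySeq
      rw [Metric.cauchySeq_iff] at hgc ⊢
      intro δ hδ
      obtain ⟨N, hN⟩ := hgc (ε * δ) (by positivity)
      refine ⟨N, fun m hm n hn => ?_⟩
      have h1 := hlow (φ m - φ n)
      have h2 := hN m hm n hn
      rw [dist_eq_norm, ← hφ', ← hφ'] at h2
      have e : A (φ m - φ n) - μ • J (φ m - φ n) =
          A (φ m) - μ • J (φ m) - (A (φ n) - μ • J (φ n)) := by
        rw [map_sub, map_sub, smul_sub]; abel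
      rw [e] at h1
      rw [dist_eq_norm, ← map_sub]
      exact lt_of_mul_lt_mul_left (h1.trans_lt h2) hε.le
    obtain ⟨x, hx⟩ := cauchySeq_tendsto_of_complete hcau
    have hA : Filter.Tendsto (fun n => A (φ n)) Filter.atTop (nhds (f + μ • x)) := by
      have := hlim.add (hx.const_smul μ)
      simpa [← hφ'] using this
    obtain ⟨u, hu1, hu2⟩ := apply_eq_of_mem_closure_core hT
      (mem_closure_of_tendsto (hx.prodMk_nhds hA)
        (Filter.Eventually.of_forall fun n => ⟨φ n, rfl⟩))
    exact ⟨u, by rw [hu1, hu2]; abel⟩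
  choose r hr using hsurj
  let R₀ : H →ₗ[ℂ] H :=
    { toFun := fun f => r f
      map_add' := fun f g => by
        rw [← Submodule.coe_add]
        congr 1
        apply hinj
        rw [hr, LinearPMap.map_add, Submodule.coe_add, smul_add, add_sub_add_comm, hr, hr]
      map_smul' := fun c f => by
        rw [RingHom.id_apply, ← Submodule.coe_smul]
        congr 1
        apply hinj
        rw [hr, LinearPMap.map_smul, Submodule.coe_smul, smul_comm μ c, ← smul_sub, hr] }
  refine ⟨R₀.mkContinuous ε⁻¹ fun f => ?_, fun f => ⟨r f, rfl, hr f⟩, fun u => ?_⟩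
  · have := hlowT (r f)
    rw [hr] at this
    rw [inv_mul_eq_div, le_div_iff₀ hε, mul_comm]
    exact this
  · change ((r (T u - μ • (u : H)) : T.domain) : H) = u
    rw [hinj _ _ (hr _)]

end Core

/-! ### Differential operators on the Schwartz space -/

lemma IsBInfty.deriv {q : ℝ → ℂ} (hq : IsBInfty q) : IsBInfty (deriv q) := by
  refine ⟨?_, fun j => ?_⟩
  · exact (contDiff_infty_iff_deriv.1 hq.1).2
  · obtain ⟨C, hC⟩ := hq.2 (j + 1)
    exact ⟨C, fun x => by rw [← iteratedDeriv_succ']; exact hC x⟩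

lemma IsBInfty.hasTemperateGrowth {q : ℝ → ℂ} (hq : IsBInfty q) : q.HasTemperateGrowth := by
  refine ⟨hq.1, fun n => ?_⟩
  obtain ⟨C, hC⟩ := hq.2 n
  exact ⟨0, C, fun x => by
    rw [pow_zero, mul_one, norm_iteratedFDeriv_eq_norm_iteratedDeriv]; exact hC x⟩

lemma IsBInfty.exists_bound {q : ℝ → ℂ} (hq : IsBInfty q) : ∃ C, 0 ≤ C ∧ ∀ x, ‖q x‖ ≤ C := by
  obtain ⟨C, hC⟩ := hq.2 0
  refine ⟨C, (norm_nonneg _).trans (hC 0), fun x => ?_⟩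
  simpa using hC x

lemma isBInfty_const (c : ℂ) : IsBInfty fun _ => c := by
  refine ⟨contDiff_const, fun j => ⟨‖c‖, fun x => ?_⟩⟩
  rw [iteratedDeriv_const]
  split_ifs <;> simp

lemma IsBInfty.const_mul {q : ℝ → ℂ} (hq : IsBInfty q) (c : ℂ) : IsBInfty fun x => c * q x := by
  refine ⟨contDiff_const.mul hq.1, fun j => ?_⟩
  obtain ⟨C, hC⟩ := hq.2 j
  refine ⟨‖c‖ * C, fun x => ?_⟩
  rw [iteratedDeriv_const_mul_field, norm_mul]
  exact mul_le_mul_of_nonneg_left (hC x) (norm_nonneg c)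

lemma iteratedDeriv_conj (j : ℕ) (q : ℝ → ℂ) :
    iteratedDeriv j (fun x => (starRingEnd ℂ) (q x)) =
      fun x => (starRingEnd ℂ) (iteratedDeriv j q x) := by
  induction j with
  | zero => simp
  | succ j ih =>
    rw [iteratedDeriv_succ, ih, iteratedDeriv_succ]
    funext x
    exact deriv.star

lemma IsBInfty.conj {q : ℝ → ℂ} (hq : IsBInfty q) : IsBInfty fun x => (starRingEnd ℂ) (q x) := by
  refine ⟨Complex.conjCLE.contDiff.comp hq.1, fun j => ?_⟩
  obtain ⟨C, hC⟩ := hq.2 j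
  refine ⟨C, fun x => ?_⟩
  rw [iteratedDeriv_conj, RCLike.norm_conj]
  exact hC x

/-- The inclusion of the Schwartz space into `L²(ℝ)`. -/
def schwartzToL2 : 𝓢(ℝ, ℂ) →ₗ[ℂ] L2R := (SchwartzMap.toLpCLM ℂ ℂ 2 volume).toLinearMap

/-- The momentum operator `-i d/dx` on the Schwartz space. -/
def momentumOp : Module.End ℂ 𝓢(ℝ, ℂ) :=
  (-Complex.I) • (SchwartzMap.derivCLM ℂ ℂ).toLinearMap

/-- Multiplication by a function of temperate growth on the Schwartz space. -/
def mulOp (q : ℝ → ℂ) : Module.End ℂ 𝓢(ℝ, ℂ) := (SchwartzMap.smulLeftCLM ℂ q).toLinearMap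

lemma schwartzToL2_injective : Function.Injective schwartzToL2 :=
  SchwartzMap.injective_toLp 2 volume

lemma coeFn_schwartzToL2 (φ : 𝓢(ℝ, ℂ)) : (schwartzToL2 φ : ℝ → ℂ) =ᵐ[volume] φ :=
  φ.coeFn_toLp 2 volume

lemma denseRange_schwartzToL2 : Dense (Set.range schwartzToL2) :=
  SchwartzMap.denseRange_toLpCLM (F := ℂ) (μ := (volume : Measure ℝ))
    (by norm_num : (2 : ENNReal) ≠ ⊤)

lemma inner_schwartzToL2 (φ ψ : 𝓢(ℝ, ℂ)) :
    inner ℂ (schwartzToL2 φ) (schwartzToL2 ψ) = ∫ x, (starRingEnd ℂ) (φ x) * ψ x := by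
  refine (SchwartzMap.inner_toL2_toL2_eq φ ψ).trans (integral_congr_ae (.of_forall fun x => ?_))
  simp [mul_comm]

lemma mulOp_apply {q : ℝ → ℂ} (hq : IsBInfty q) (φ : 𝓢(ℝ, ℂ)) (x : ℝ) :
    mulOp q φ x = q x * φ x :=
  SchwartzMap.smulLeftCLM_apply_apply hq.hasTemperateGrowth φ x

lemma momentumOp_apply (φ : 𝓢(ℝ, ℂ)) (x : ℝ) : momentumOp φ x = -Complex.I * deriv φ x := rfl

lemma momentumOp_pow_apply (j : ℕ) (φ : 𝓢(ℝ, ℂ)) (x : ℝ) :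
    (momentumOp ^ j) φ x = momentumPow j φ x := by
  induction j generalizing x with
  | zero => simp [momentumPow]
  | succ j ih =>
    have e : ⇑((momentumOp ^ j) φ) = momentumPow j φ := funext ih
    rw [pow_succ', Module.End.mul_apply, momentumOp_apply, e, add_comm j 1,
      ← momentumPow_momentumPow]
    simp [momentumPow]

lemma mulOp_const (c : ℂ) : mulOp (fun _ => c) = c • 1 := by
  ext φ x
  rw [mulOp_apply (isBInfty_const c)]
  rfl

lemma mulOp_const_mul {q : ℝ → ℂ} (hq : IsBInfty q) (c : ℂ) :
    mulOp (fun x => c * q x) = c • mulOp q := by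
  ext φ x
  rw [mulOp_apply (hq.const_mul c), LinearMap.smul_apply, smul_apply, mulOp_apply hq,
    smul_eq_mul]
  ring

/-- The Leibniz rule for the momentum operator. -/
lemma momentumOp_mul_mulOp {q : ℝ → ℂ} (hq : IsBInfty q) :
    momentumOp * mulOp q = mulOp q * momentumOp + mulOp (fun x => -Complex.I * deriv q x) := by
  ext φ x
  have e : ⇑(mulOp q φ) = fun y => q y * φ y := funext (mulOp_apply hq φ)
  rw [Module.End.mul_apply, momentumOp_apply, e, LinearMap.add_apply, add_apply,
    mulOp_apply (hq.deriv.const_mul _), Module.End.mul_apply, mulOp_apply hq, momentumOp_apply,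
    deriv_fun_mul (hq.1.differentiable (by simp)).differentiableAt φ.differentiableAt]
  ring

/-- The momentum operator is symmetric. -/
lemma inner_momentumOp (φ ψ : 𝓢(ℝ, ℂ)) :
    inner ℂ (schwartzToL2 (momentumOp φ)) (schwartzToL2 ψ) =
      inner ℂ (schwartzToL2 φ) (schwartzToL2 (momentumOp ψ)) := by
  have h := SchwartzMap.integral_bilinear_deriv_right_eq_neg_left φ ψ
    ((ContinuousLinearMap.mul ℝ ℂ).comp (Complex.conjCLE : ℂ →L[ℝ] ℂ))
  simp only [ContinuousLinearMap.comp_apply, ContinuousLinearMap.mul_apply',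
    ContinuousLinearEquiv.coe_coe, Complex.conjCLE_apply] at h
  rw [inner_schwartzToL2, inner_schwartzToL2]
  simp only [momentumOp_apply, map_mul, map_neg, Complex.conj_I, neg_neg]
  calc ∫ x, Complex.I * (starRingEnd ℂ) (deriv φ x) * ψ x
      = Complex.I * ∫ x, (starRingEnd ℂ) (deriv φ x) * ψ x := by
        rw [← integral_const_mul]; simp only [mul_assoc]
    _ = -Complex.I * ∫ x, (starRingEnd ℂ) (φ x) * deriv ψ x := by rw [h]; ring
    _ = _ := by rw [← integral_const_mul]; congr 1; funext x; ring

lemma inner_momentumOp_pow (j : ℕ) (φ ψ : 𝓢(ℝ, ℂ)) :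
    inner ℂ (schwartzToL2 ((momentumOp ^ j) φ)) (schwartzToL2 ψ) =
      inner ℂ (schwartzToL2 φ) (schwartzToL2 ((momentumOp ^ j) ψ)) := by
  induction j generalizing φ with
  | zero => rfl
  | succ j ih =>
    rw [pow_succ, Module.End.mul_apply, ih, inner_momentumOp, ← Module.End.mul_apply,
      ← pow_succ', ← pow_succ]

lemma inner_mulOp {q : ℝ → ℂ} (hq : IsBInfty q) (φ ψ : 𝓢(ℝ, ℂ)) :
    inner ℂ (schwartzToL2 φ) (schwartzToL2 (mulOp q ψ)) =
      inner ℂ (schwartzToL2 (mulOp (fun x => (starRingEnd ℂ) (q x)) φ)) (schwartzToL2 ψ) := by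
  rw [inner_schwartzToL2, inner_schwartzToL2]
  congr 1
  funext x
  rw [mulOp_apply hq, mulOp_apply hq.conj, map_mul, Complex.conj_conj]
  ring

lemma norm_mulOp_le {q : ℝ → ℂ} (hq : IsBInfty q) {C : ℝ} (hC : ∀ x, ‖q x‖ ≤ C)
    (φ : 𝓢(ℝ, ℂ)) : ‖schwartzToL2 (mulOp q φ)‖ ≤ C * ‖schwartzToL2 φ‖ := by
  refine Lp.norm_le_mul_norm_of_ae_le_mul ?_
  filter_upwards [coeFn_schwartzToL2 φ, coeFn_schwartzToL2 (mulOp q φ)] with x h1 h2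
  rw [h1, h2, mulOp_apply hq, norm_mul]
  exact mul_le_mul_of_nonneg_right (hC x) (norm_nonneg _)

lemma le_re_inner_mulOp {q : ℝ → ℂ} (hq : IsBInfty q) {δ : ℝ} (hδ : ∀ x, δ ≤ (q x).re)
    (φ : 𝓢(ℝ, ℂ)) :
    δ * ‖schwartzToL2 φ‖ ^ 2 ≤ (inner ℂ (schwartzToL2 φ) (schwartzToL2 (mulOp q φ))).re := by
  have hint (ψ : 𝓢(ℝ, ℂ)) : Integrable fun x => (starRingEnd ℂ) (φ x) * ψ x := by
    have := L2.integrable_inner (𝕜 := ℂ) (schwartzToL2 φ) (schwartzToL2 ψ)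
    refine this.congr ?_
    filter_upwards [coeFn_schwartzToL2 φ, coeFn_schwartzToL2 ψ] with x h1 h2
    rw [h1, h2]
    simp [mul_comm]
  have e : ‖schwartzToL2 φ‖ ^ 2 = (inner ℂ (schwartzToL2 φ) (schwartzToL2 φ)).re := by
    exact (inner_self_eq_norm_sq (𝕜 := ℂ) _).symm
  rw [e, inner_schwartzToL2, inner_schwartzToL2, ← Complex.reCLM_apply, ← Complex.reCLM_apply,
    ← ContinuousLinearMap.integral_comp_comm _ (hint φ),
    ← ContinuousLinearMap.integral_comp_comm _ (hint _), ← integral_const_mul]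
  refine integral_mono ((Complex.reCLM.integrable_comp (hint φ)).const_mul _)
    (Complex.reCLM.integrable_comp (hint _)) fun x => ?_
  have e1 : (starRingEnd ℂ) (φ x) * (q x * φ x) = ((‖φ x‖ ^ 2 : ℝ) : ℂ) * q x := by
    rw [mul_left_comm, Complex.conj_mul', mul_comm]; push_cast; ring
  have e2 : (starRingEnd ℂ) (φ x) * φ x = ((‖φ x‖ ^ 2 : ℝ) : ℂ) := by
    rw [Complex.conj_mul']; push_cast; ring
  simp only [mulOp_apply hq, Complex.reCLM_apply]
  rw [e1, e2, Complex.re_ofReal_mul, Complex.ofReal_re, mul_comm]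
  exact mul_le_mul_of_nonneg_left (hδ x) (sq_nonneg _)

/-! ### Differential operators filtered by order -/

/-- The differential operators on the Schwartz space of order less than `N` with coefficients
bounded together with all their derivatives. -/
def diffOps (N : ℕ) : Submodule ℂ (Module.End ℂ 𝓢(ℝ, ℂ)) :=
  Submodule.span ℂ {L | ∃ j < N, ∃ q, IsBInfty q ∧ L = mulOp q * momentumOp ^ j}

lemma mulOp_mul_mem_diffOps {q : ℝ → ℂ} (hq : IsBInfty q) {j N : ℕ} (hj : j < N) :
    mulOp q * momentumOp ^ j ∈ diffOps N := Submodule.subset_span ⟨j, hj, q, hq, rfl⟩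

lemma momentumOp_pow_mem_diffOps {j N : ℕ} (hj : j < N) : momentumOp ^ j ∈ diffOps N := by
  have := mulOp_mul_mem_diffOps (isBInfty_const 1) hj
  rwa [mulOp_const, one_smul, one_mul] at this

lemma diffOps_mono {N M : ℕ} (h : N ≤ M) : diffOps N ≤ diffOps M :=
  Submodule.span_mono fun _ ⟨j, hj, q, hq, e⟩ => ⟨j, hj.trans_le h, q, hq, e⟩

lemma momentumOp_mul_mem_diffOps {N : ℕ} {L : Module.End ℂ 𝓢(ℝ, ℂ)} (hL : L ∈ diffOps N) :
    momentumOp * L ∈ diffOps (N + 1) := by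
  induction hL using Submodule.span_induction with
  | mem L h =>
    obtain ⟨j, hj, q, hq, rfl⟩ := h
    rw [← mul_assoc, momentumOp_mul_mulOp hq, add_mul, mul_assoc, ← pow_succ']
    exact add_mem (mulOp_mul_mem_diffOps hq (by omega))
      (mulOp_mul_mem_diffOps (hq.deriv.const_mul _) (by omega))
  | zero => rw [mul_zero]; exact zero_mem _
  | add L L' _ _ h h' => rw [mul_add]; exact add_mem h h'
  | smul c L _ h => rw [mul_smul_comm]; exact Submodule.smul_mem _ c h

/-- Commuting a coefficient past `D` differentiates the coefficient and loses one order. -/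
lemma momentumOp_pow_mul_mulOp_sub_mem {q : ℝ → ℂ} (hq : IsBInfty q) (i : ℕ) :
    momentumOp ^ i * mulOp q - mulOp q * momentumOp ^ i ∈ diffOps i := by
  induction i with
  | zero => simp
  | succ i ih =>
    have e : momentumOp ^ (i + 1) * mulOp q - mulOp q * momentumOp ^ (i + 1) =
        momentumOp * (momentumOp ^ i * mulOp q - mulOp q * momentumOp ^ i) +
          mulOp (fun x => -Complex.I * deriv q x) * momentumOp ^ i := by
      rw [mul_sub, ← mul_assoc, ← mul_assoc, momentumOp_mul_mulOp hq, add_mul, pow_succ',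
        mul_assoc (mulOp q) momentumOp]
      abel
    rw [e]
    exact add_mem (momentumOp_mul_mem_diffOps ih)
      (mulOp_mul_mem_diffOps (hq.deriv.const_mul _) (by omega))

lemma momentumOp_pow_mul_mulOp_mem {q : ℝ → ℂ} (hq : IsBInfty q) {i N : ℕ} (hi : i < N) :
    momentumOp ^ i * mulOp q ∈ diffOps N := by
  have h1 := diffOps_mono hi.le (momentumOp_pow_mul_mulOp_sub_mem hq i)
  have := add_mem h1 (mulOp_mul_mem_diffOps hq hi)
  rwa [sub_add_cancel] at this

/-! ### Interpolation and Gårding's inequality -/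

/-- One factor `D` is moved across the inner product, then Cauchy–Schwarz applies. -/
lemma norm_momentumOp_pow_sq_le (j : ℕ) (φ : 𝓢(ℝ, ℂ)) :
    ‖schwartzToL2 ((momentumOp ^ (j + 1)) φ)‖ ^ 2 ≤
      ‖schwartzToL2 ((momentumOp ^ j) φ)‖ * ‖schwartzToL2 ((momentumOp ^ (j + 2)) φ)‖ := by
  have e : inner ℂ (schwartzToL2 ((momentumOp ^ (j + 1)) φ))
      (schwartzToL2 ((momentumOp ^ (j + 1)) φ)) =
      inner ℂ (schwartzToL2 ((momentumOp ^ j) φ)) (schwartzToL2 ((momentumOp ^ (j + 2)) φ)) := by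
    conv_lhs => rw [pow_succ' momentumOp j, Module.End.mul_apply, inner_momentumOp]
    rw [← Module.End.mul_apply, ← Module.End.mul_apply, ← pow_two, ← pow_add,
      add_comm 2 j]
  rw [← inner_self_eq_norm_sq (𝕜 := ℂ), e]
  exact (Complex.re_le_norm _).trans (norm_inner_le_norm _ _)

lemma exists_norm_momentumOp_pow_le_succ (j : ℕ) : ∀ ε > (0 : ℝ), ∃ C, 0 ≤ C ∧ ∀ φ,
    ‖schwartzToL2 ((momentumOp ^ j) φ)‖ ≤
      ε * ‖schwartzToL2 ((momentumOp ^ (j + 1)) φ)‖ + C * ‖schwartzToL2 φ‖ := by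
  induction j with
  | zero =>
    intro ε hε
    refine ⟨1, zero_le_one, fun φ => ?_⟩
    rw [pow_zero, Module.End.one_apply, one_mul]
    exact le_add_of_nonneg_left (by positivity)
  | succ j ih =>
    intro ε hε
    obtain ⟨C, hC0, hC⟩ := ih ε hε
    refine ⟨C / ε, by positivity, fun φ => ?_⟩
    have h1 := hC φ
    have h2 := norm_momentumOp_pow_sq_le j φ
    rw [show j + 1 + 1 = j + 2 from rfl]
    set x := ‖schwartzToL2 ((momentumOp ^ (j + 1)) φ)‖
    set y := ‖schwartzToL2 ((momentumOp ^ (j + 2)) φ)‖ with hy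
    set z := ‖schwartzToL2 φ‖ with hz
    have hy0 : 0 ≤ y := norm_nonneg _
    have hz0 : 0 ≤ z := norm_nonneg _
    -- With `x² ≤ (ε x + C z) y`, the assumption `x > ε y + (C / ε) z` gives `x² > ε x y + (C / ε) z
    -- x`. Since also `x ≥ ε y`, the right side is at least `ε x y + C z y`, a contradiction.
    by_contra! hlt
    have hw : 0 ≤ C / ε * z := by positivity
    have hx0 : 0 < x := lt_of_le_of_lt (by positivity) hlt
    have h3 : x ^ 2 ≤ (ε * x + C * z) * y := h2.trans (by gcongr)
    have h4 : (ε * y + C / ε * z) * x < x ^ 2 := by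
      rw [pow_two]; exact mul_lt_mul_of_pos_right hlt hx0
    have h5 : C / ε * z * (ε * y) ≤ C / ε * z * x := by
      gcongr
      linarith
    have h6 : C / ε * z * (ε * y) = C * z * y := by field_simp
    nlinarith

lemma exists_norm_momentumOp_pow_le {j n : ℕ} (hj : j < n) : ∀ ε > (0 : ℝ), ∃ C, 0 ≤ C ∧ ∀ φ,
    ‖schwartzToL2 ((momentumOp ^ j) φ)‖ ≤
      ε * ‖schwartzToL2 ((momentumOp ^ n) φ)‖ + C * ‖schwartzToL2 φ‖ := by
  induction n with
  | zero => omega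
  | succ n ih =>
    intro ε hε
    rcases Nat.lt_succ_iff_lt_or_eq.1 hj with h | rfl
    · obtain ⟨C, hC0, hC⟩ := ih h 1 one_pos
      obtain ⟨C', hC0', hC'⟩ := exists_norm_momentumOp_pow_le_succ n ε hε
      refine ⟨C + C', by positivity, fun φ => ?_⟩
      linarith [hC φ, hC' φ]
    · exact exists_norm_momentumOp_pow_le_succ j ε hε

/-- Operators of order less than `N` are small relative to `D ^ N`. -/
theorem exists_norm_le_of_mem_diffOps {N : ℕ} {L : Module.End ℂ 𝓢(ℝ, ℂ)} (hL : L ∈ diffOps N) :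
    ∀ ε > (0 : ℝ), ∃ C, 0 ≤ C ∧ ∀ φ,
      ‖schwartzToL2 (L φ)‖ ≤
        ε * ‖schwartzToL2 ((momentumOp ^ N) φ)‖ + C * ‖schwartzToL2 φ‖ := by
  induction hL using Submodule.span_induction with
  | mem L h =>
    obtain ⟨j, hj, q, hq, rfl⟩ := h
    intro ε hε
    obtain ⟨K, hK0, hK⟩ := hq.exists_bound
    -- `K + 1` replaces `K` to avoid dividing by zero.
    obtain ⟨C, hC0, hC⟩ := exists_norm_momentumOp_pow_le hj (ε / (K + 1)) (by positivity)
    refine ⟨(K + 1) * C, by positivity, fun φ => ?_⟩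
    calc ‖schwartzToL2 ((mulOp q * momentumOp ^ j) φ)‖
        ≤ (K + 1) * ‖schwartzToL2 ((momentumOp ^ j) φ)‖ :=
          norm_mulOp_le hq (fun x => (hK x).trans (by linarith)) _
      _ ≤ (K + 1) * (ε / (K + 1) * ‖schwartzToL2 ((momentumOp ^ N) φ)‖ +
            C * ‖schwartzToL2 φ‖) := by gcongr; exact hC φ
      _ = _ := by field_simp
  | zero =>
    intro ε hε
    refine ⟨0, le_rfl, fun φ => ?_⟩
    simp only [LinearMap.zero_apply, map_zero, norm_zero]
    positivity
  | add L L' _ _ h h' =>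
    intro ε hε
    obtain ⟨C, hC0, hC⟩ := h (ε / 2) (by positivity)
    obtain ⟨C', hC0', hC'⟩ := h' (ε / 2) (by positivity)
    refine ⟨C + C', by positivity, fun φ => ?_⟩
    rw [LinearMap.add_apply, map_add]
    linarith [norm_add_le (schwartzToL2 (L φ)) (schwartzToL2 (L' φ)), hC φ, hC' φ]
  | smul c L _ h =>
    intro ε hε
    obtain ⟨C, hC0, hC⟩ := h (ε / (‖c‖ + 1)) (by positivity)
    refine ⟨(‖c‖ + 1) * C, by positivity, fun φ => ?_⟩
    rw [LinearMap.smul_apply, map_smul, norm_smul]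
    calc ‖c‖ * ‖schwartzToL2 (L φ)‖
        ≤ (‖c‖ + 1) * (ε / (‖c‖ + 1) * ‖schwartzToL2 ((momentumOp ^ N) φ)‖ +
            C * ‖schwartzToL2 φ‖) := by gcongr; exacts [by linarith, hC φ]
      _ = _ := by field_simp

lemma mul_add_le_sq {ε C x y : ℝ} (hε : 0 < ε) :
    (ε / 2 * x + C * y) * x ≤ ε * x ^ 2 + C ^ 2 / (2 * ε) * y ^ 2 := by
  have h : 0 ≤ (ε * x - C * y) ^ 2 / (2 * ε) := by positivity
  have e : ε * x ^ 2 + C ^ 2 / (2 * ε) * y ^ 2 - (ε / 2 * x + C * y) * x =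
      (ε * x - C * y) ^ 2 / (2 * ε) := by
    field_simp
    ring
  linarith

lemma exists_norm_inner_momentumOp_pow_le {l : ℕ} {L : Module.End ℂ 𝓢(ℝ, ℂ)}
    (hL : L ∈ diffOps l) : ∀ ε > (0 : ℝ), ∃ C, 0 ≤ C ∧ ∀ φ,
      ‖inner ℂ (schwartzToL2 (L φ)) (schwartzToL2 ((momentumOp ^ l) φ))‖ ≤
        ε * ‖schwartzToL2 ((momentumOp ^ l) φ)‖ ^ 2 + C * ‖schwartzToL2 φ‖ ^ 2 := by
  intro ε hε
  obtain ⟨C, hC0, hC⟩ := exists_norm_le_of_mem_diffOps hL (ε / 2) (by positivity)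
  refine ⟨C ^ 2 / (2 * ε), by positivity, fun φ => ?_⟩
  exact (norm_inner_le_norm _ _).trans
    ((mul_le_mul_of_nonneg_right (hC φ) (norm_nonneg _)).trans (mul_add_le_sq hε))

/-- Integration by parts: `l` derivatives stay on the right, the other `i` pass to the left together
with the conjugate coefficient. -/
lemma inner_mulOp_momentumOp_pow {q : ℝ → ℂ} (hq : IsBInfty q) (i l : ℕ) (φ : 𝓢(ℝ, ℂ)) :
    inner ℂ (schwartzToL2 φ) (schwartzToL2 ((mulOp q * momentumOp ^ (i + l)) φ)) =
      inner ℂ (schwartzToL2 ((momentumOp ^ i * mulOp (fun x => (starRingEnd ℂ) (q x))) φ))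
        (schwartzToL2 ((momentumOp ^ l) φ)) := by
  rw [Module.End.mul_apply, inner_mulOp hq, pow_add, Module.End.mul_apply, ← inner_momentumOp_pow,
    Module.End.mul_apply]

/-- The form of an operator of order less than `2 l` is small relative to `‖D ^ l φ‖ ^ 2`. -/
theorem exists_norm_inner_le_of_mem_diffOps {l : ℕ} {L : Module.End ℂ 𝓢(ℝ, ℂ)}
    (hL : L ∈ diffOps (l + l)) : ∀ ε > (0 : ℝ), ∃ C, 0 ≤ C ∧ ∀ φ,
      ‖inner ℂ (schwartzToL2 φ) (schwartzToL2 (L φ))‖ ≤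
        ε * ‖schwartzToL2 ((momentumOp ^ l) φ)‖ ^ 2 + C * ‖schwartzToL2 φ‖ ^ 2 := by
  induction hL using Submodule.span_induction with
  | mem L h =>
    obtain ⟨j, hj, q, hq, rfl⟩ := h
    intro ε hε
    -- Below order `l`, Cauchy–Schwarz and interpolation suffice. Otherwise the excess `i = j - l <
    -- l` derivatives are moved to the left factor, which then has order below `l`.
    rcases lt_or_ge j l with hjl | hjl
    · obtain ⟨C, hC0, hC⟩ := exists_norm_le_of_mem_diffOps (mulOp_mul_mem_diffOps hq hjl) 1 one_pos
      refine ⟨C + 1 / ε, by positivity, fun φ => ?_⟩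
      set x := ‖schwartzToL2 ((momentumOp ^ l) φ)‖
      set y := ‖schwartzToL2 φ‖
      have h1 : y * (1 * x + C * y) ≤ ε * x ^ 2 + (C + 1 / ε) * y ^ 2 := by
        have h : 0 ≤ ((ε * x - y) ^ 2 + ε * x * (ε * x) + y ^ 2) / (2 * ε) := by positivity
        have e : ε * x ^ 2 + (C + 1 / ε) * y ^ 2 - y * (1 * x + C * y) =
            ((ε * x - y) ^ 2 + ε * x * (ε * x) + y ^ 2) / (2 * ε) := by
          field_simp
          ring
        linarith
      exact (norm_inner_le_norm _ _).trans
        ((mul_le_mul_of_nonneg_left (hC φ) (norm_nonneg _)).trans h1)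
    · obtain ⟨i, rfl⟩ := Nat.exists_eq_add_of_le' hjl
      obtain ⟨C, hC0, hC⟩ := exists_norm_inner_momentumOp_pow_le
        (momentumOp_pow_mul_mulOp_mem hq.conj (by omega : i < l)) ε hε
      refine ⟨C, hC0, fun φ => ?_⟩
      rw [inner_mulOp_momentumOp_pow hq]
      exact hC φ
  | zero =>
    intro ε hε
    refine ⟨0, le_rfl, fun φ => ?_⟩
    simp only [LinearMap.zero_apply, map_zero, inner_zero_right, norm_zero]
    positivity
  | add L L' _ _ h h' =>
    intro ε hε
    obtain ⟨C, hC0, hC⟩ := h (ε / 2) (by positivity)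
    obtain ⟨C', hC0', hC'⟩ := h' (ε / 2) (by positivity)
    refine ⟨C + C', by positivity, fun φ => ?_⟩
    rw [LinearMap.add_apply, map_add, inner_add_right]
    refine (norm_add_le _ _).trans ?_
    linarith [hC φ, hC' φ]
  | smul c L _ h =>
    intro ε hε
    obtain ⟨C, hC0, hC⟩ := h (ε / (‖c‖ + 1)) (by positivity)
    refine ⟨(‖c‖ + 1) * C, by positivity, fun φ => ?_⟩
    rw [LinearMap.smul_apply, map_smul, inner_smul_right, norm_mul]
    calc ‖c‖ * ‖inner ℂ (schwartzToL2 φ) (schwartzToL2 (L φ))‖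
        ≤ (‖c‖ + 1) * (ε / (‖c‖ + 1) * ‖schwartzToL2 ((momentumOp ^ l) φ)‖ ^ 2 +
            C * ‖schwartzToL2 φ‖ ^ 2) := by gcongr; exacts [by linarith, hC φ]
      _ = _ := by field_simp

/-- The difference is the form of the commutator of `D ^ l` with the conjugate of `q`, of order
below `l`, against `D ^ l φ`. -/
lemma exists_norm_inner_leading_sub_le {q : ℝ → ℂ} (hq : IsBInfty q) (l : ℕ) :
    ∀ ε > (0 : ℝ), ∃ C, 0 ≤ C ∧ ∀ φ,
      ‖inner ℂ (schwartzToL2 φ) (schwartzToL2 ((mulOp q * momentumOp ^ (l + l)) φ)) -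
        inner ℂ (schwartzToL2 ((momentumOp ^ l) φ))
          (schwartzToL2 (mulOp q ((momentumOp ^ l) φ)))‖ ≤
        ε * ‖schwartzToL2 ((momentumOp ^ l) φ)‖ ^ 2 + C * ‖schwartzToL2 φ‖ ^ 2 := by
  intro ε hε
  obtain ⟨C, hC0, hC⟩ := exists_norm_inner_momentumOp_pow_le
    (momentumOp_pow_mul_mulOp_sub_mem hq.conj l) ε hε
  refine ⟨C, hC0, fun φ => ?_⟩
  rw [inner_mulOp_momentumOp_pow hq, inner_mulOp hq, ← inner_sub_left, ← map_sub]
  exact hC φ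

/-- Gårding's inequality. -/
theorem exists_le_re_inner {q : ℝ → ℂ} (hq : IsBInfty q) {δ : ℝ} (hδ0 : 0 < δ)
    (hδ : ∀ x, δ ≤ (q x).re) {l : ℕ} {L : Module.End ℂ 𝓢(ℝ, ℂ)} (hL : L ∈ diffOps (l + l)) :
    ∃ C, 0 ≤ C ∧ ∀ φ,
      δ / 2 * ‖schwartzToL2 ((momentumOp ^ l) φ)‖ ^ 2 - C * ‖schwartzToL2 φ‖ ^ 2 ≤
        (inner ℂ (schwartzToL2 φ)
          (schwartzToL2 ((mulOp q * momentumOp ^ (l + l) + L) φ))).re := by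
  obtain ⟨C, hC0, hC⟩ := exists_norm_inner_leading_sub_le hq l (δ / 4) (by positivity)
  obtain ⟨C', hC0', hC'⟩ := exists_norm_inner_le_of_mem_diffOps hL (δ / 4) (by positivity)
  refine ⟨C + C', by positivity, fun φ => ?_⟩
  rw [LinearMap.add_apply, map_add, inner_add_right, Complex.add_re]
  have h1 := (abs_le.1 (Complex.abs_re_le_norm _)).1.trans' (neg_le_neg (hC φ))
  have h2 := (abs_le.1 (Complex.abs_re_le_norm _)).1.trans' (neg_le_neg (hC' φ))
  have h3 := le_re_inner_mulOp hq hδ ((momentumOp ^ l) φ)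
  rw [Complex.sub_re] at h1
  linarith

theorem exists_norm_inner_le {q : ℝ → ℂ} (hq : IsBInfty q) {l : ℕ}
    {L : Module.End ℂ 𝓢(ℝ, ℂ)} (hL : L ∈ diffOps (l + l)) :
    ∃ C, 0 ≤ C ∧ ∀ φ,
      ‖inner ℂ (schwartzToL2 φ) (schwartzToL2 ((mulOp q * momentumOp ^ (l + l) + L) φ))‖ ≤
        C * (‖schwartzToL2 ((momentumOp ^ l) φ)‖ ^ 2 + ‖schwartzToL2 φ‖ ^ 2) := by
  obtain ⟨K, hK0, hK⟩ := hq.exists_bound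
  obtain ⟨C, hC0, hC⟩ := exists_norm_inner_leading_sub_le hq l 1 one_pos
  obtain ⟨C', hC0', hC'⟩ := exists_norm_inner_le_of_mem_diffOps hL 1 one_pos
  refine ⟨K + C + C' + 2, by positivity, fun φ => ?_⟩
  rw [LinearMap.add_apply, map_add, inner_add_right]
  have h1 := hC φ
  have h2 := hC' φ
  have h3 : ‖inner ℂ (schwartzToL2 ((momentumOp ^ l) φ))
      (schwartzToL2 (mulOp q ((momentumOp ^ l) φ)))‖ ≤
      K * ‖schwartzToL2 ((momentumOp ^ l) φ)‖ ^ 2 := by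
    refine (norm_inner_le_norm _ _).trans ?_
    have := mul_le_mul_of_nonneg_left (norm_mulOp_le hq hK ((momentumOp ^ l) φ))
      (norm_nonneg (schwartzToL2 ((momentumOp ^ l) φ)))
    linarith
  have h4 := norm_add_le
    (inner ℂ (schwartzToL2 φ) (schwartzToL2 ((mulOp q * momentumOp ^ (l + l)) φ)))
    (inner ℂ (schwartzToL2 φ) (schwartzToL2 (L φ)))
  have h5 := norm_le_insert'
    (inner ℂ (schwartzToL2 φ) (schwartzToL2 ((mulOp q * momentumOp ^ (l + l)) φ)))
    (inner ℂ (schwartzToL2 ((momentumOp ^ l) φ)) (schwartzToL2 (mulOp q ((momentumOp ^ l) φ))))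
  have hx := sq_nonneg ‖schwartzToL2 ((momentumOp ^ l) φ)‖
  have hy := sq_nonneg ‖schwartzToL2 φ‖
  nlinarith [mul_nonneg hK0 hy, mul_nonneg hC0 hx, mul_nonneg hC0' hx]

/-! ### Dense range far from the numerical range -/

/-- The operator `1 - (2π)⁻² d²/dx²`, with symbol `1 + ξ²`. -/
def besselOp : Module.End ℂ 𝓢(ℝ, ℂ) :=
  1 + (((2 * Real.pi) ^ 2)⁻¹ : ℂ) • momentumOp ^ 2

/-- With the kernel `exp (-2πi x ξ)` the symbol of `D` is `2π ξ`, which explains the factor `(2π)⁻²`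
in `besselOp`. -/
lemma momentumOp_eq_fourierMultiplier (φ : 𝓢(ℝ, ℂ)) :
    momentumOp φ =
      (2 * Real.pi : ℝ) • SchwartzMap.fourierMultiplierCLM ℂ (fun x : ℝ => inner ℝ x 1) φ := by
  have h := SchwartzMap.lineDeriv_eq_fourierMultiplierCLM (1 : ℝ) φ
  have e : momentumOp φ = (-Complex.I) • LineDeriv.lineDerivOp (1 : ℝ) φ := by
    ext x
    rw [momentumOp_apply, smul_apply, SchwartzMap.lineDerivOp_apply_eq_fderiv, smul_eq_mul,
      fderiv_apply_one_eq_deriv]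
  rw [e, h, smul_smul]
  ext x
  rw [smul_apply, smul_apply, Complex.real_smul, smul_eq_mul]
  congr 1
  push_cast
  linear_combination (-(2 * Real.pi : ℂ)) * Complex.I_sq

lemma besselOp_surjective : Function.Surjective besselOp := by
  intro φ
  let g : ℝ → ℝ := fun x => (1 + ‖x‖ ^ 2) ^ (-1 : ℝ)
  have hg : g.HasTemperateGrowth := Function.hasTemperateGrowth_one_add_norm_sq_rpow ℝ (-1)
  have hi : (fun x : ℝ => inner ℝ x (1 : ℝ)).HasTemperateGrowth := by fun_prop
  -- The preimage is obtained with the reciprocal symbol `(1 + ξ²)⁻¹`, itself of temperate growth.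
  refine ⟨SchwartzMap.fourierMultiplierCLM ℂ g φ, ?_⟩
  have e1 : (((2 * Real.pi) ^ 2)⁻¹ : ℂ) •
      (momentumOp ^ 2) (SchwartzMap.fourierMultiplierCLM ℂ g φ) =
      SchwartzMap.fourierMultiplierCLM ℂ
        ((fun x : ℝ => inner ℝ x (1 : ℝ)) * ((fun x : ℝ => inner ℝ x (1 : ℝ)) * g)) φ := by
    rw [pow_two momentumOp, Module.End.mul_apply, momentumOp_eq_fourierMultiplier,
      momentumOp_eq_fourierMultiplier, map_smul,
      SchwartzMap.fourierMultiplierCLM_fourierMultiplierCLM_apply hi hg,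
      SchwartzMap.fourierMultiplierCLM_fourierMultiplierCLM_apply hi (hi.mul hg), smul_smul]
    ext x
    rw [smul_apply, smul_apply, Complex.real_smul, smul_eq_mul]
    have : (Real.pi : ℂ) ≠ 0 := by exact_mod_cast Real.pi_ne_zero
    push_cast
    field_simp
  rw [besselOp, LinearMap.add_apply, LinearMap.smul_apply, e1, Module.End.one_apply,
    SchwartzMap.fourierMultiplierCLM_apply, SchwartzMap.fourierMultiplierCLM_apply,
    ← FourierTransform.fourierInv_add]
  refine Eq.trans ?_ (FourierTransform.fourierInv_fourier_eq (F := 𝓢(ℝ, ℂ)) φ)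
  congr 1
  ext x
  rw [add_apply, SchwartzMap.smulLeftCLM_apply_apply hg,
    SchwartzMap.smulLeftCLM_apply_apply (hi.mul (hi.mul hg)), ← add_smul]
  have h0 : (1 + ‖x‖ ^ 2) ≠ 0 := by positivity
  have e2 : g x + ((fun x : ℝ => inner ℝ x (1 : ℝ)) *
      ((fun x : ℝ => inner ℝ x (1 : ℝ)) * g)) x = 1 := by
    simp only [g, Pi.mul_apply, Real.rpow_neg_one, RCLike.inner_apply, conj_trivial, one_mul]
    rw [Real.norm_eq_abs, sq_abs] at h0 ⊢
    field_simp
  rw [e2, one_smul]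

lemma besselOp_pow_surjective (l : ℕ) : Function.Surjective (besselOp ^ l) := by
  rw [Module.End.coe_pow]
  exact besselOp_surjective.iterate l

lemma besselOp_pow_sub_mem_diffOps (l : ℕ) :
    besselOp ^ l - ((((2 * Real.pi) ^ 2)⁻¹ : ℂ) ^ l) • momentumOp ^ (l + l) ∈
      diffOps (l + l) := by
  induction l with
  | zero => simp
  | succ l ih =>
    set c : ℂ := ((2 * Real.pi) ^ 2)⁻¹ with hc
    set L := besselOp ^ l - (c ^ l) • momentumOp ^ (l + l) with hL
    have e : besselOp ^ (l + 1) - (c ^ (l + 1)) • momentumOp ^ (l + 1 + (l + 1)) =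
        L + c • (momentumOp * (momentumOp * L)) + c ^ l • momentumOp ^ (l + l) := by
      rw [hL, show l + 1 + (l + 1) = 2 + (l + l) by omega, pow_add momentumOp 2,
        pow_succ' besselOp, besselOp, ← hc]
      simp only [pow_two, add_mul, one_mul, mul_sub, smul_sub, smul_mul_assoc, mul_smul_comm,
        smul_smul, mul_assoc, pow_succ' c]
      abel
    rw [e]
    refine add_mem (add_mem (diffOps_mono (by omega) ih) (Submodule.smul_mem _ _ ?_))
      (Submodule.smul_mem _ _ (momentumOp_pow_mem_diffOps (by omega)))
    exact diffOps_mono (by omega) (momentumOp_mul_mem_diffOps (momentumOp_mul_mem_diffOps ih))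

lemma commute_momentumOp_besselOp_pow (l : ℕ) : Commute momentumOp (besselOp ^ l) := by
  refine Commute.pow_right ?_ l
  exact (Commute.one_right _).add_right (((Commute.refl _).pow_right 2).smul_right _)

/-- Each further factor adds a nonnegative term: the previous form evaluated at `D φ`, as `D` is
symmetric and commutes with the powers. -/
lemma norm_sq_le_re_inner_besselOp_pow (l : ℕ) (φ : 𝓢(ℝ, ℂ)) :
    ‖schwartzToL2 φ‖ ^ 2 ≤
      (inner ℂ (schwartzToL2 φ) (schwartzToL2 ((besselOp ^ l) φ))).re := by
  induction l generalizing φ with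
  | zero => exact (inner_self_eq_norm_sq (𝕜 := ℂ) _).ge
  | succ l ih =>
    have h1 := ih φ
    have h2 := ih (momentumOp φ)
    have e : inner ℂ (schwartzToL2 φ) (schwartzToL2 ((besselOp ^ (l + 1)) φ)) =
        inner ℂ (schwartzToL2 φ) (schwartzToL2 ((besselOp ^ l) φ)) +
          ((((2 * Real.pi) ^ 2)⁻¹ : ℝ) : ℂ) * inner ℂ (schwartzToL2 (momentumOp φ))
            (schwartzToL2 ((besselOp ^ l) (momentumOp φ))) := by
      have hcomm : (besselOp ^ l) (momentumOp φ) = momentumOp ((besselOp ^ l) φ) := by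
        rw [← Module.End.mul_apply, ← Module.End.mul_apply,
          (commute_momentumOp_besselOp_pow l).eq]
      rw [hcomm, inner_momentumOp, pow_succ', Module.End.mul_apply]
      conv_lhs => rw [besselOp]
      rw [LinearMap.add_apply, LinearMap.smul_apply, map_add, map_smul, inner_add_right,
        inner_smul_right, Module.End.one_apply, pow_two momentumOp, Module.End.mul_apply]
      push_cast
      rfl
    rw [e, Complex.add_re, Complex.re_ofReal_mul]
    have h3 : 0 ≤ ((2 * Real.pi) ^ 2)⁻¹ * (inner ℂ (schwartzToL2 (momentumOp φ))
        (schwartzToL2 ((besselOp ^ l) (momentumOp φ)))).re :=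
      mul_nonneg (by positivity) (h2.trans' (sq_nonneg _))
    linarith

/-- A strongly elliptic operator plus a large constant is accretive with dense range. -/
theorem exists_coercive_and_dense_range {q : ℝ → ℂ} (hq : IsBInfty q) {δ : ℝ} (hδ0 : 0 < δ)
    (hδ : ∀ x, δ ≤ (q x).re) {l : ℕ} {L : Module.End ℂ 𝓢(ℝ, ℂ)} (hL : L ∈ diffOps (l + l)) :
    ∃ R : ℝ, (∀ φ, ‖schwartzToL2 φ‖ ^ 2 ≤ (inner ℂ (schwartzToL2 φ)
        (schwartzToL2 ((mulOp q * momentumOp ^ (l + l) + L) φ) + (R : ℂ) • schwartzToL2 φ)).re) ∧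
      Dense (Set.range (schwartzToL2 ∘ₗ (mulOp q * momentumOp ^ (l + l) + L) +
        (R : ℂ) • schwartzToL2)) := by
  obtain ⟨C, hC0, hC⟩ := exists_le_re_inner hq hδ0 hδ hL
  have hcoer (φ : 𝓢(ℝ, ℂ)) : ‖schwartzToL2 φ‖ ^ 2 ≤ (inner ℂ (schwartzToL2 φ)
      (schwartzToL2 ((mulOp q * momentumOp ^ (l + l) + L) φ) +
        ((C + 1 : ℝ) : ℂ) • schwartzToL2 φ)).re := by
    have h1 := hC φ
    have h3 : (inner ℂ (schwartzToL2 φ) (schwartzToL2 φ)).re = ‖schwartzToL2 φ‖ ^ 2 :=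
      inner_self_eq_norm_sq (𝕜 := ℂ) _
    rw [inner_add_right, inner_smul_right, Complex.add_re, Complex.re_ofReal_mul, h3]
    have h2 : 0 ≤ δ / 2 * ‖schwartzToL2 ((momentumOp ^ l) φ)‖ ^ 2 := by positivity
    linarith
  refine ⟨C + 1, hcoer, ?_⟩
  set R : ℝ := C + 1 with hR
  set c : ℝ := (((2 * Real.pi) ^ 2)⁻¹) ^ l with hc
  have hc0 : 0 < c := by positivity
  set L₁ : Module.End ℂ 𝓢(ℝ, ℂ) := besselOp ^ l - (c : ℂ) • momentumOp ^ (l + l) with hL₁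
  have hL₁mem : L₁ ∈ diffOps (l + l) := by
    have := besselOp_pow_sub_mem_diffOps l
    rw [hL₁, hc]
    push_cast
    exact this
  set B₀ := schwartzToL2 ∘ₗ (mulOp q * momentumOp ^ (l + l) + L) + (R : ℂ) • schwartzToL2 with hB₀
  set B₁ := schwartzToL2 ∘ₗ (besselOp ^ l) with hB₁
  have hB₀' (φ) : B₀ φ = schwartzToL2 (mulOp q ((momentumOp ^ (l + l)) φ)) +
      schwartzToL2 (L φ) + (R : ℂ) • schwartzToL2 φ := by
    rw [hB₀, LinearMap.add_apply, LinearMap.comp_apply, LinearMap.add_apply, map_add,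
      LinearMap.smul_apply, Module.End.mul_apply]
  have hB₁' (φ) : B₁ φ = (c : ℂ) • schwartzToL2 ((momentumOp ^ (l + l)) φ) +
      schwartzToL2 (L₁ φ) := by
    rw [hB₁, hL₁, LinearMap.comp_apply, LinearMap.sub_apply, LinearMap.smul_apply, map_sub,
      map_smul]
    abel
  set ν : ℝ := min δ c with hν
  have hν0 : 0 < ν := lt_min hδ0 hc0
  obtain ⟨K, hK0, hK⟩ := hq.exists_bound
  obtain ⟨C₀, hC₀, hLC⟩ := exists_norm_le_of_mem_diffOps hL (ν / 4) (by positivity)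
  obtain ⟨C₁, hC₁, hLC₁⟩ := exists_norm_le_of_mem_diffOps hL₁mem (ν / 4) (by positivity)
  refine dense_range_of_continuity_method B₀ B₁
    ((K + c + ν) * ((1 + C₀ + C₁ + |R|) * 2 / ν) + (C₀ + C₁ + |R|)) (fun s hs φ => ?_) ?_
  swap
  · have e : Set.range B₁ = Set.range schwartzToL2 := by
      rw [hB₁, LinearMap.coe_comp, Set.range_comp, (besselOp_pow_surjective l).range_eq,
        Set.image_univ]
    rw [e]
    exact denseRange_schwartzToL2
  set u := schwartzToL2 φ with hu
  set D := schwartzToL2 ((momentumOp ^ (l + l)) φ) with hD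
  set Q := schwartzToL2 (mulOp q ((momentumOp ^ (l + l)) φ)) with hQ
  set X := ((1 - s : ℝ) : ℂ) • B₀ φ + (s : ℂ) • B₁ φ with hX
  have hs1 : (0 : ℝ) ≤ 1 - s := by linarith [hs.2]
  have hns : ‖(s : ℂ)‖ = s := by rw [Complex.norm_real, Real.norm_of_nonneg hs.1]
  have hns' : ‖((1 - s : ℝ) : ℂ)‖ = 1 - s := by rw [Complex.norm_real, Real.norm_of_nonneg hs1]
  -- Both endpoints of the segment have real part at least `‖u‖²`, hence so does every convex
  -- combination.
  have huX : ‖u‖ ≤ ‖X‖ := by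
    have := mul_norm_le_of_re_inner (x := u) (y := X) (ε := 1) ?_
    · linarith
    · have h1 : ‖u‖ ^ 2 ≤ (inner ℂ u (B₀ φ)).re := hcoer φ
      have h2 : ‖u‖ ^ 2 ≤ (inner ℂ u (B₁ φ)).re := norm_sq_le_re_inner_besselOp_pow l φ
      rw [hX, inner_add_right, inner_smul_right, inner_smul_right, Complex.add_re,
        Complex.re_ofReal_mul, Complex.re_ofReal_mul]
      nlinarith [hs.1]
  -- Ellipticity is uniform on the segment: the leading coefficient `(1 - s) q + s c` has real part
  -- at least `min δ c`.
  have hlead : ν * ‖D‖ ≤ ‖((1 - s : ℝ) : ℂ) • Q + ((s : ℂ) * c) • D‖ := by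
    refine mul_norm_le_of_re_inner ?_
    have h1 : δ * ‖D‖ ^ 2 ≤ (inner ℂ D Q).re := le_re_inner_mulOp hq hδ _
    have h2 : (inner ℂ D D).re = ‖D‖ ^ 2 := inner_self_eq_norm_sq (𝕜 := ℂ) D
    rw [inner_add_right, inner_smul_right, inner_smul_right, Complex.add_re,
      Complex.re_ofReal_mul, ← Complex.ofReal_mul, Complex.re_ofReal_mul, h2]
    have h3 : ν * ‖D‖ ^ 2 ≤ δ * ‖D‖ ^ 2 := by gcongr; exact min_le_left _ _
    have h4 : ν * ‖D‖ ^ 2 ≤ c * ‖D‖ ^ 2 := by gcongr; exact min_le_right _ _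
    nlinarith [hs.1]
  have hLφ := hLC φ
  have hL₁φ := hLC₁ φ
  -- The lower-order parts `L` and `L₁` each absorb at most `ν / 4` of `‖D‖`, so `ν / 2` survives.
  have hDX : ‖D‖ ≤ (1 + C₀ + C₁ + |R|) * 2 / ν * ‖X‖ := by
    have e : ((1 - s : ℝ) : ℂ) • Q + ((s : ℂ) * c) • D = X - (((1 - s : ℝ) : ℂ) •
        (schwartzToL2 (L φ) + (R : ℂ) • u) + (s : ℂ) • schwartzToL2 (L₁ φ)) := by
      rw [hX, hB₀', hB₁']
      module
    have h1 : ‖((1 - s : ℝ) : ℂ) • (schwartzToL2 (L φ) + (R : ℂ) • u) +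
        (s : ℂ) • schwartzToL2 (L₁ φ)‖ ≤
        ‖schwartzToL2 (L φ)‖ + |R| * ‖u‖ + ‖schwartzToL2 (L₁ φ)‖ := by
      refine (norm_add_le _ _).trans (add_le_add ?_ ?_)
      · rw [norm_smul, hns']
        have h2 := norm_add_le (schwartzToL2 (L φ)) ((R : ℂ) • u)
        rw [norm_smul, Complex.norm_real, Real.norm_eq_abs] at h2
        exact (mul_le_of_le_one_left (norm_nonneg _) (by linarith [hs.1])).trans h2
      · rw [norm_smul, hns]
        exact mul_le_of_le_one_left (norm_nonneg _) hs.2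
    rw [e] at hlead
    have h2 := hlead.trans (norm_sub_le _ _)
    have h3 : ν / 2 * ‖D‖ ≤ (1 + C₀ + C₁ + |R|) * ‖X‖ := by
      have h4 : (C₀ + C₁ + |R|) * ‖u‖ ≤ (C₀ + C₁ + |R|) * ‖X‖ := by gcongr
      linarith
    rw [div_mul_eq_mul_div, le_div_iff₀ hν0]
    linarith
  have hQD : ‖Q‖ ≤ K * ‖D‖ := norm_mulOp_le hq hK _
  have hsub : ‖B₁ φ - B₀ φ‖ ≤ (K + c + ν) * ‖D‖ + (C₀ + C₁ + |R|) * ‖u‖ := by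
    rw [hB₀', hB₁']
    have h1 := norm_sub_le ((c : ℂ) • D + schwartzToL2 (L₁ φ))
      (Q + schwartzToL2 (L φ) + (R : ℂ) • u)
    have h2 := norm_add_le ((c : ℂ) • D) (schwartzToL2 (L₁ φ))
    have h3 := norm_add₃_le (a := Q) (b := schwartzToL2 (L φ)) (c := (R : ℂ) • u)
    rw [norm_smul, Complex.norm_real, Real.norm_eq_abs] at h2 h3
    rw [abs_of_pos hc0] at h2
    have h4 : 0 ≤ ν * ‖D‖ := by positivity
    linarith
  calc ‖B₁ φ - B₀ φ‖ ≤ (K + c + ν) * ((1 + C₀ + C₁ + |R|) * 2 / ν * ‖X‖) +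
        (C₀ + C₁ + |R|) * ‖X‖ := hsub.trans (by gcongr)
    _ = _ := by ring

/-! ### The Schur complement -/

/-- Differential operators with bounded coefficients have formal adjoints. -/
lemma exists_formal_adjoint {N : ℕ} {L : Module.End ℂ 𝓢(ℝ, ℂ)} (hL : L ∈ diffOps N) :
    ∃ L' : Module.End ℂ 𝓢(ℝ, ℂ), ∀ φ ψ, inner ℂ (schwartzToL2 φ) (schwartzToL2 (L ψ)) =
      inner ℂ (schwartzToL2 (L' φ)) (schwartzToL2 ψ) := by
  induction hL using Submodule.span_induction with
  | mem L h =>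
    obtain ⟨j, -, q, hq, rfl⟩ := h
    exact ⟨momentumOp ^ j * mulOp (fun x => (starRingEnd ℂ) (q x)), fun φ ψ => by
      rw [Module.End.mul_apply, inner_mulOp hq, ← inner_momentumOp_pow, Module.End.mul_apply]⟩
  | zero => exact ⟨0, by simp⟩
  | add L L' _ _ h h' =>
    obtain ⟨M, hM⟩ := h
    obtain ⟨M', hM'⟩ := h'
    exact ⟨M + M', fun φ ψ => by
      rw [LinearMap.add_apply, LinearMap.add_apply, map_add, map_add, inner_add_left,
        inner_add_right, hM, hM']⟩
  | smul c L _ h =>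
    obtain ⟨M, hM⟩ := h
    exact ⟨(starRingEnd ℂ) c • M, fun φ ψ => by
      rw [LinearMap.smul_apply, LinearMap.smul_apply, map_smul, map_smul, inner_smul_left,
        inner_smul_right, hM, Complex.conj_conj]⟩

/-- A densely defined operator on the Schwartz space with a formal adjoint is closable. -/
lemma isClosable_of_formal_adjoint {T : L2R →ₗ.[ℂ] L2R} {L L' : Module.End ℂ 𝓢(ℝ, ℂ)}
    (hT : (T.graph : Set (L2R × L2R)) = Set.range fun φ => (schwartzToL2 φ, schwartzToL2 (L φ)))
    (hL : ∀ φ ψ, inner ℂ (schwartzToL2 φ) (schwartzToL2 (L ψ)) =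
      inner ℂ (schwartzToL2 (L' φ)) (schwartzToL2 ψ)) : T.IsClosable := by
  refine ⟨T.graph.topologicalClosure.toLinearPMap,
    (Submodule.toLinearPMap_graph_eq _ fun p hp h0 => ?_).symm⟩
  have hp' : p ∈ closure (Set.range fun φ => (schwartzToL2 φ, schwartzToL2 (L φ))) := by
    rw [← hT]; exact hp
  -- The adjoint relation passes to the closed graph; with `p.1 = 0` it makes `p.2` orthogonal to a
  -- dense subspace.
  have h1 (φ : 𝓢(ℝ, ℂ)) : inner ℂ (schwartzToL2 φ) p.2 = inner ℂ (schwartzToL2 (L' φ)) p.1 := by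
    have hcl : IsClosed {p : L2R × L2R | inner ℂ (schwartzToL2 φ) p.2 =
        inner ℂ (schwartzToL2 (L' φ)) p.1} := isClosed_eq (by fun_prop) (by fun_prop)
    exact closure_minimal (by rintro _ ⟨ψ, rfl⟩; exact hL φ ψ) hcl hp'
  have h2 : inner ℂ p.2 p.2 = 0 := by
    refine denseRange_schwartzToL2.induction (P := fun x => inner ℂ x p.2 = 0) ?_
      (isClosed_eq (by fun_prop) (by fun_prop)) p.2
    rintro _ ⟨φ, rfl⟩
    rw [h1, h0, inner_zero_right]
  exact inner_self_eq_zero.1 h2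

/-- The differential operator `∑_{j ≤ N} q_j D ^ j` on the Schwartz space. -/
def diffOp (N : ℕ) (q : ℕ → ℝ → ℂ) : Module.End ℂ 𝓢(ℝ, ℂ) :=
  ∑ j ∈ Finset.range (N + 1), mulOp (q j) * momentumOp ^ j

lemma diffOp_apply {N : ℕ} {q : ℕ → ℝ → ℂ} (hq : ∀ j ≤ N, IsBInfty (q j)) (φ : 𝓢(ℝ, ℂ)) :
    ⇑(diffOp N q φ) = diffExpr N q φ := by
  funext x
  rw [diffOp, LinearMap.sum_apply, sum_apply, diffExpr]
  refine Finset.sum_congr rfl fun j hj => ?_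
  rw [Module.End.mul_apply, mulOp_apply (hq j (by have := Finset.mem_range.1 hj; omega)),
    momentumOp_pow_apply]

lemma diffOp_mem_diffOps {N : ℕ} {q : ℕ → ℝ → ℂ} (hq : ∀ j ≤ N, IsBInfty (q j)) :
    diffOp N q ∈ diffOps (N + 1) :=
  Submodule.sum_mem _ fun j hj =>
    mulOp_mul_mem_diffOps (hq j (by have := Finset.mem_range.1 hj; omega)) (Finset.mem_range.1 hj)

lemma exists_smul_diffOp_eq {N : ℕ} {q : ℕ → ℝ → ℂ} (hq : ∀ j ≤ N, IsBInfty (q j)) (e : ℂ) :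
    ∃ L ∈ diffOps N, e • diffOp N q = mulOp (fun x => e * q N x) * momentumOp ^ N + L := by
  refine ⟨e • ∑ j ∈ Finset.range N, mulOp (q j) * momentumOp ^ j,
    Submodule.smul_mem _ _ (Submodule.sum_mem _ fun j hj => ?_), ?_⟩
  · have := Finset.mem_range.1 hj
    exact mulOp_mul_mem_diffOps (hq j (by omega)) this
  · rw [diffOp, Finset.sum_range_succ, smul_add, mulOp_const_mul (hq N le_rfl), smul_mul_assoc,
      add_comm]

lemma graph_schurOp₀ (K : MatrixCoeffs) (hA : K.AssumptionA) (lam : ℂ)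
    (hd : lam ∉ closure (Set.range K.d)) (hB : ∀ j ≤ K.m, IsBInfty (K.schurCoeff lam j)) :
    ((schurOp₀ K hA lam hd).graph : Set (L2R × L2R)) =
      Set.range fun φ => (schwartzToL2 φ, schwartzToL2 (diffOp K.m (K.schurCoeff lam) φ)) := by
  have hop (φ : 𝓢(ℝ, ℂ)) : (schwartzToL2 (diffOp K.m (K.schurCoeff lam) φ) : ℝ → ℂ) =ᵐ[volume]
      K.schurExpr lam φ := by
    rw [schurExpr_eq_diffExpr hA hd (φ.smooth ⊤), ← diffOp_apply hB]
    exact coeFn_schwartzToL2 _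
  ext p
  rw [SetLike.mem_coe, mem_graph_schurOp₀]
  constructor
  · rintro ⟨φ, h1, h2⟩
    exact ⟨φ, Prod.ext (Lp.ext ((coeFn_schwartzToL2 φ).trans h1.symm))
      (Lp.ext ((hop φ).trans h2.symm))⟩
  · rintro ⟨φ, rfl⟩
    exact ⟨φ, coeFn_schwartzToL2 φ, hop φ⟩

lemma graph_schurOp (K : MatrixCoeffs) (hA : K.AssumptionA) (lam : ℂ)
    (hd : lam ∉ closure (Set.range K.d)) (hB : ∀ j ≤ K.m, IsBInfty (K.schurCoeff lam j)) :
    ((schurOp K hA lam hd).graph : Set (L2R × L2R)) = closure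
      (Set.range fun φ => (schwartzToL2 φ,
        (schwartzToL2 ∘ₗ diffOp K.m (K.schurCoeff lam)) φ)) := by
  have hg := graph_schurOp₀ K hA lam hd hB
  obtain ⟨L', hL'⟩ := exists_formal_adjoint (diffOp_mem_diffOps hB)
  -- Closability is essential: `LinearPMap.closure` leaves a non-closable operator unchanged.
  rw [schurOp, ← (isClosable_of_formal_adjoint hg hL').graph_closure_eq_closure_graph,
    Submodule.topologicalClosure_coe, hg]
  rfl

/-- A region `|Im (e z)| ≤ M (Re (e z) + C)` is a sector of semi-angle `arctan M`. -/
lemma mem_closedSector_of_abs_im_le {θ M C : ℝ} {z : ℂ}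
    (hz : |(Complex.exp (θ * Complex.I) * z).im| ≤
      M * ((Complex.exp (θ * Complex.I) * z).re + C)) (hM : 0 < M) :
    z ∈ closedSector (-(C * Complex.exp (-(θ * Complex.I)))) (-θ) (Real.arctan M) := by
  set e := Complex.exp (θ * Complex.I) with he
  -- After rotation and translation the region is `|Im y| ≤ M Re y`; the polar coordinates of `y`
  -- are the required `r` and `t`.
  set y : ℂ := e * z + C with hy
  have hyre : y.re = (e * z).re + C := by simp [hy]
  have hyim : y.im = (e * z).im := by simp [hy]
  have hre : 0 ≤ y.re := by
    rw [hyre]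
    exact nonneg_of_mul_nonneg_right ((abs_nonneg _).trans hz) hM
  refine ⟨‖y‖, y.arg, norm_nonneg y, ?_, ?_⟩
  · rw [← hyim, ← hyre] at hz
    rcases hre.eq_or_lt with h0 | h0
    · have him : y.im = 0 := by
        rw [← h0, mul_zero] at hz
        exact abs_nonpos_iff.1 hz
      have hy0 : y = 0 := Complex.ext h0.symm him
      rw [hy0, Complex.arg_zero, abs_zero]
      exact Real.arctan_nonneg.2 hM.le
    · have harg : y.arg = Real.arctan (y.im / y.re) := by
        rw [Complex.arg_of_re_nonneg hre, Real.arctan_eq_arcsin]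
        congr 1
        have hn : ‖y‖ = y.re * √(1 + (y.im / y.re) ^ 2) := by
          rw [Complex.norm_def, Complex.normSq_apply,
            show y.re * y.re + y.im * y.im = y.re ^ 2 * (1 + (y.im / y.re) ^ 2) by
              field_simp, Real.sqrt_mul (sq_nonneg _), Real.sqrt_sq hre]
        rw [hn]
        field_simp
      rw [harg, abs_le, ← Real.arctan_neg]
      have h1 : |y.im / y.re| ≤ M := by
        rw [abs_div, abs_of_pos h0, div_le_iff₀ h0]
        exact hz
      rw [abs_le] at h1
      exact ⟨Real.arctan_mono h1.1, Real.arctan_mono h1.2⟩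
  · have h1 : (‖y‖ : ℂ) * Complex.exp (y.arg * Complex.I) = y := Complex.norm_mul_exp_arg_mul_I y
    have h2 : Complex.exp (-(θ * Complex.I)) * e = 1 := by
      rw [he, ← Complex.exp_add, neg_add_cancel, Complex.exp_zero]
    have h3 : Complex.exp ((-θ + y.arg : ℝ) * Complex.I) =
        Complex.exp (-(θ * Complex.I)) * Complex.exp (y.arg * Complex.I) := by
      rw [← Complex.exp_add]
      congr 1
      push_cast
      ring
    rw [h3, mul_left_comm, h1, hy]
    linear_combination (-z) * h2

end

/-! ### The sector and the resolvent set of the Schur complement -/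

theorem mainTheorem8 (K : MatrixCoeffs) (hm : Even K.m) (hA : K.AssumptionA) (hC : K.AssumptionC)
    (lam : ℂ) (hΔ : lam ∉ closure (Set.range K.Delta)) (hd : lam ∉ closure (Set.range K.d)) :
    (∃ (z₀ : ℂ) (ψ ϑ : ℝ), 0 ≤ ϑ ∧ ϑ < Real.pi / 2 ∧
      closure (numRange (schurOp K hA lam hd)) ⊆ closedSector z₀ ψ ϑ) ∧
    (closure (numRange (schurOp K hA lam hd)))ᶜ ⊆ resolventSetPMap (schurOp K hA lam hd) := by
  have hlam : lam ∉ closure (Set.range K.Delta) ∪ closure (Set.range K.d) := by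
    rintro (h | h)
    exacts [hΔ h, hd h]
  have hB := hC.schur_bounded lam hlam
  obtain ⟨θ, δ, hδ0, hδ⟩ := hC.strongly_elliptic lam hlam
  obtain ⟨l, hl⟩ := hm
  set e : ℂ := Complex.exp (θ * Complex.I) with he
  have hnorm : ‖e‖ = 1 := Complex.norm_exp_ofReal_mul_I θ
  set P := diffOp K.m (K.schurCoeff lam) with hP
  obtain ⟨L, hL, heP⟩ := exists_smul_diffOp_eq hB e
  have hq : IsBInfty fun x => e * K.schurCoeff lam K.m x := (hB _ le_rfl).const_mul e
  rw [← hP, hl] at heP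
  rw [hl] at hL hq hδ
  obtain ⟨C₁, hC₁, hlow⟩ := exists_le_re_inner hq hδ0 hδ hL
  obtain ⟨C₂, hC₂, hup⟩ := exists_norm_inner_le hq hL
  obtain ⟨R, hR, hdense⟩ := exists_coercive_and_dense_range hq hδ0 hδ hL
  rw [← heP] at hlow hup hR hdense
  have hgraph := graph_schurOp K hA lam hd hB
  rw [← hP] at hgraph
  -- Chosen so that `M * (δ / 2) ≥ C₂`; the `+ 1` keeps `M` positive. The shift `C` below turns
  -- Gårding's bound on unit vectors into `δ / 2 * (x + 1)`, matching the upper bound `C₂ * (x +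
  -- 1)`.
  set M : ℝ := 2 * C₂ / δ + 1 with hM
  have hM0 : 0 < M := by positivity
  set C : ℝ := C₁ + δ / 2 with hCdef
  have hsec : ∀ z ∈ formRange schwartzToL2 (schwartzToL2 ∘ₗ P),
      |(e * z).im| ≤ M * ((e * z).re + C) := by
    rintro _ ⟨φ, hφ, rfl⟩
    have h1 := hlow φ
    have h2 := (Complex.abs_im_le_norm _).trans (hup φ)
    rw [LinearMap.smul_apply, map_smul, inner_smul_right, hφ, one_pow] at h1 h2
    rw [LinearMap.comp_apply]
    set x := ‖schwartzToL2 ((momentumOp ^ l) φ)‖ ^ 2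
    set y := e * inner ℂ (schwartzToL2 φ) (schwartzToL2 (P φ))
    have hx : 0 ≤ x := sq_nonneg _
    have h3 : δ / 2 * (x + 1) ≤ y.re + C := by rw [hCdef]; linarith
    calc |y.im| ≤ C₂ * (x + 1) := h2
      _ ≤ M * (δ / 2) * (x + 1) := by
          gcongr
          rw [hM]
          field_simp
          linarith
      _ = M * (δ / 2 * (x + 1)) := by ring
      _ ≤ M * (y.re + C) := by gcongr
  rw [closure_numRange_eq hgraph]
  refine ⟨⟨_, _, _, Real.arctan_nonneg.2 hM0.le, Real.arctan_lt_pi_div_two M, fun z hz =>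
    mem_closedSector_of_abs_im_le (θ := θ) (C := C) ?_ hM0⟩, fun μ hμ => ?_⟩
  · have hcl : IsClosed {z : ℂ | |(e * z).im| ≤ M * ((e * z).re + C)} :=
      isClosed_le (by fun_prop) (by fun_prop)
    exact closure_minimal hsec hcl hz
  · obtain ⟨ε, hε, hεlow⟩ := exists_lower_bound_of_notMem_closure_formRange _ _ hμ
    refine mem_resolventSetPMap_of_core hgraph hε hεlow ?_
    refine dense_range_sub_of_notMem_closure_formRange schwartzToL2 (schwartzToL2 ∘ₗ P)
      schwartzToL2_injective hnorm hM0.le hsec (R := R) (fun φ => ?_) ?_ hμ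
    · have := hR φ
      rwa [LinearMap.smul_apply, map_smul] at this
    · rwa [LinearMap.comp_smul] at hdense
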